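/- **Theorem (on normal bases).** Let $k$ be a field and let $A$ be an associative unital $k$-algebra generated by $a_1,\dots,a_s$. Let $V_A(n)$ be the dimension of the span of the monomials of length at most $n$ in the generators, and $T_A(n)=V_A(n)-V_A(n-1)$, $V_A(-1)=0$. Assume that $A$ is a *boundary algebra*, i.e. $T_A(n)-n$ is bounded. *Conventions.* Order the words in the alphabet $a_1<\dots<a_s$ first by length, then lexicographically. A word is *irreducible* if its value in $A$ is not a linear combination of values of smaller words; the irreducible words form the *normal basis* of $A$. A *superword* is a right-infinite, left-infinite or two-sided infinite word; it is a superword *in* $A$ if all its finite subwords are irreducible. $T_W(n)$ is the number of subwords of length $n$ of $W$. $W$ is *uniformly recurrent* if each of its subwords occurs in it infinitely often (in both directions if $W$ is two-sided), and for each subword $v$ there is $N(v)$ such that every subword of $W$ of length at least $N(v)$ contains $v$. Two superwords are *equivalent* if they have the same finite subwords. An *obstruction* for $W$ is a finite word which is not a subword of $W$ although all its proper subwords are. For a nonempty finite word $u$, $u^{\infty/2}c$, $c\,u^{\infty/2}$ and $u^\infty$ denote the left-infinite word $\cdots uuc$, the right-infinite word $cuu\cdots$ and the two-sided word $\cdots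 uuu\cdots$. Below, $u,v,u_i,v_i,R_j$ are nonempty finite words, $c,c_i,d_i,e_j,f_j,L_i,L_j'$ are finite words, and the numbers $r_1,r_2,\dots$ of members of a list may be $0$. **Case 1.** Suppose that there is no uniformly recurrent non-periodic superword in $A$. Then the normal basis of $A$ is the set of all finite subwords of a family consisting of 1. one two-sided word $u^{\infty/2}cv^{\infty/2}$ that is not a shift of $u^\infty$; 2. a finite set $\mu$ of finite words; 3. words $u_i^{\infty/2}c_i$, $i=1,\dots,r_1$; 4. words $d_iv_i^{\infty/2}$, $i=1,\dots,r_2$; 5. words $e_jR_j^{k}f_j$, $k\in K_j\subseteq\mathbb N$, $j=1,\dots,r_3$; 6. a set of words $W_\alpha=E_\alpha u^{n_\alpha}cv^{m_\alpha}F_\alpha$, with $u,c,v$ as in 1 and with $E_\alpha,F_\alpha$ of bounded length, such that for some constant $C>0$ and every $k$ fewer than $C$ of the words $W_\alpha$ have length $k$. **Case 2.** Suppose that $W$ is a uniformly recurrent non-periodic superword in $A$. Then there is a constant $K\in\mathbb N$ with $T_W(n)=n+K$ for all sufficiently large $n$, and the normal basis of $A$ is the set of all finite subwords of a family consisting of 1.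 the word $W$; 2. a finite set $\mu$ of finite words; 3. words $u_i^{\infty/2}c_i$, $i=1,\dots,s_1$; 4. words $d_iv_i^{\infty/2}$, $i=1,\dots,s_2$; 5. words $e_jR_j^{k}f_j$, $k\in K_j\subseteq\mathbb N$, $j=1,\dots,s_3$; 6. right-infinite words $L_iO_iW_i$, $i=1,\dots,k_1$, where $W_i$ is a right-infinite word equivalent to $W$, $O_i$ is an obstruction for $W$, and the initial $O_i$ is the only occurrence of an obstruction for $W$ in $O_iW_i$; 7. left-infinite words $W_j'O_j'L_j'$, $j=1,\dots,k_2$, where $W_j'$ is a left-infinite word equivalent to $W$, $O_j'$ is an obstruction for $W$, and the final $O_j'$ is the only occurrence of an obstruction for $W$ in $W_j'O_j'$; 8. finitely many series of words $h^1_iTh^2_i$, $T\in\mathcal T_i$, $i=1,\dots,q$, where $h^1_i,h^2_i$ are finite words and $\mathcal T_i$ is a set of finite words, such that: a) every $T\in\mathcal T_i$ contains either exactly two occurrences of obstructions for $W$ (possibly overlapping), one at the beginning and one at the end of $T$, or exactly one occurrence, at the beginning or at the end of $T$; b) for some $C>0$, $|h^1_i|+|h^2_i|<C$ for all $i$; c)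 there is $m>0$ such that for every $k$ at most $m$ words of length $k$ are subwords of words of these series without being subwords of $W$. -/

import Mathlib

namespace BoundaryAlgebra

/-! ### Growth and the normal basis of an algebra with chosen generators -/

/-- The value in `A` of a word in the generators `a 0, …, a (s-1)`; the empty word has value `1`. -/
def evalWord {A : Type*} [Monoid A] {s : ℕ} (a : Fin s → A) (w : List (Fin s)) : A :=
  (w.map a).prod

/-- `V_A(n)`: the dimension of the span of all monomials of length at most `n`. -/
noncomputable def growthV (k : Type*) {A : Type*} [Field k] [Ring A] [Algebra k A] {s : ℕ}
    (a : Fin s → A) (n : ℕ) : ℕ :=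
  Module.finrank k
    (Submodule.span k {x : A | ∃ w : List (Fin s), w.length ≤ n ∧ x = evalWord a w})

/-- `T_A(n) = V_A(n) - V_A(n-1)`, where `V_A(-1) = 0`. -/
noncomputable def growthT (k : Type*) {A : Type*} [Field k] [Ring A] [Algebra k A] {s : ℕ}
    (a : Fin s → A) : ℕ → ℤ
  | 0 => (growthV k a 0 : ℤ)
  | n + 1 => (growthV k a (n + 1) : ℤ) - (growthV k a n : ℤ)

/-- A boundary algebra: `T_A(n) - n` is bounded. -/
def IsBoundary (k : Type*) {A : Type*} [Field k] [Ring A] [Algebra k A] {s : ℕ}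
    (a : Fin s → A) : Prop :=
  ∃ C : ℤ, ∀ n : ℕ, |growthT k a n - (n : ℤ)| ≤ C

/-- The normal basis: the irreducible words, i.e. those whose value is not a linear combination of
values of words that are smaller in the degree-lexicographic order (shorter words are smaller,
words of equal length are compared lexicographically). -/
def normalWords (k : Type*) {A : Type*} [Field k] [Ring A] [Algebra k A] {s : ℕ}
    (a : Fin s → A) : Set (List (Fin s)) :=
  {w | evalWord a w ∉ Submodule.span k
    {x : A | ∃ w' : List (Fin s), List.Shortlex (· < ·) w' w ∧ x = evalWord a w'}}

/-! ### Superwords -/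

/-- Superwords (infinite words).
`right f` is the word `f 0, f 1, f 2, …`, infinite to the right;
`left f` is the word `…, f 2, f 1, f 0`, infinite to the left;
`two f` is the word `…, f (-1), f 0, f 1, …`, infinite in both directions. -/
inductive Superword (α : Type*) where
  | right (f : ℕ → α) : Superword α
  | left (f : ℕ → α) : Superword α
  | two (f : ℤ → α) : Superword α

namespace Superword

/-- The letter at an integer position. A right superword occupies the positions `0, 1, 2, …`,
a left superword the positions `…, -3, -2, -1`. -/
def letter {α : Type*} : Superword α → ℤ → Option α
  | right f, Int.ofNat n => some (f n)
  | right _, Int.negSucc _ => none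
  | left _, Int.ofNat _ => none
  | left f, Int.negSucc n => some (f n)
  | two f, i => some (f i)

/-- The finite word `v` occurs in the superword `W` starting at position `i`. -/
def OccursAt {α : Type*} (W : Superword α) (v : List α) (i : ℤ) : Prop :=
  ∀ j : ℕ, j < v.length → W.letter (i + (j : ℤ)) = v[j]?

/-- The set of finite subwords of a superword. -/
def factors {α : Type*} (W : Superword α) : Set (List α) :=
  {v | ∃ i : ℤ, W.OccursAt v i}

/-- The growth function `T_W(n)`: the number of subwords of length `n`. -/
noncomputable def complexity {α : Type*} (W : Superword α) (n : ℕ) : ℕ :=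
  Set.ncard {v : List α | v ∈ W.factors ∧ v.length = n}

/-- Every subword occurs infinitely often (for a two-sided word: in both directions). -/
def Recurrent {α : Type*} : Superword α → Prop
  | right f => ∀ v ∈ (right f).factors, ∀ N : ℤ, ∃ i : ℤ, N ≤ i ∧ (right f).OccursAt v i
  | left f => ∀ v ∈ (left f).factors, ∀ N : ℤ, ∃ i : ℤ, i ≤ N ∧ (left f).OccursAt v i
  | two f => ∀ v ∈ (two f).factors, ∀ N : ℤ,
      (∃ i : ℤ, N ≤ i ∧ (two f).OccursAt v i) ∧ (∃ i : ℤ, i ≤ N ∧ (two f).OccursAt v i)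

/-- Uniformly recurrent superwords. -/
def UniformlyRecurrent {α : Type*} (W : Superword α) : Prop :=
  W.Recurrent ∧
    ∀ v ∈ W.factors, ∃ N : ℕ, ∀ u ∈ W.factors, N ≤ u.length → v <:+: u

/-- Periodic superwords. -/
def Periodic {α : Type*} : Superword α → Prop
  | right f => ∃ p : ℕ, 0 < p ∧ ∀ n : ℕ, f (n + p) = f n
  | left f => ∃ p : ℕ, 0 < p ∧ ∀ n : ℕ, f (n + p) = f n
  | two f => ∃ p : ℕ, 0 < p ∧ ∀ i : ℤ, f (i + (p : ℤ)) = f i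

/-- Two superwords are equivalent if they have the same finite subwords. -/
def Equivalent {α : Type*} (W W' : Superword α) : Prop :=
  W.factors = W'.factors

end Superword

/-! ### Words built from finite words -/

/-- Nonempty finite words. -/
abbrev NEWord (α : Type*) := {u : List α // u ≠ []}

/-- The reversal of a nonempty word. -/
def NEWord.reverse {α : Type*} (u : NEWord α) : NEWord α :=
  ⟨u.1.reverse, fun h => u.2 (List.reverse_eq_nil_iff.mp h)⟩

/-- The power `u ^ n` of a finite word. -/
def pow {α : Type*} (u : List α) (n : ℕ) : List α :=
  (List.replicate n u).flatten

/-- The sequence of letters of `u u u …`. -/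
def perSeq {α : Type*} (u : NEWord α) (n : ℕ) : α :=
  u.1[n % u.1.length]'(Nat.mod_lt _ (List.length_pos_iff.mpr u.2))

/-- The sequence that begins with the letters of `d` and continues with `f`. -/
def prepend {α : Type*} (d : List α) (f : ℕ → α) (n : ℕ) : α :=
  if h : n < d.length then d[n] else f (n - d.length)

/-- The superword `u^{∞/2} c`, infinite to the left. -/
def leftHalf {α : Type*} (u : NEWord α) (c : List α) : Superword α :=
  Superword.left (prepend c.reverse (perSeq u.reverse))

/-- The superword `d v^{∞/2}`, infinite to the right. -/
def rightHalf {α : Type*} (d : List α) (v : NEWord α) : Superword α :=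
  Superword.right (prepend d (perSeq v))

/-- The letters of the two-sided word `u^{∞/2} c v^{∞/2}`; the factor `c v^{∞/2}` starts at
position `0`. -/
def biSeq {α : Type*} (u : NEWord α) (c : List α) (v : NEWord α) : ℤ → α
  | Int.ofNat n => prepend c (perSeq v) n
  | Int.negSucc n => perSeq u.reverse n

/-- The letters of the two-sided periodic word `u^∞`. -/
def perBiSeq {α : Type*} (u : NEWord α) : ℤ → α :=
  biSeq u [] u

/-! ### Obstructions of a set of words -/

/-- An obstruction for a set `F` of finite words: a word not in `F` all of whose proper subwords
are in `F`. -/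
def IsObstruction {α : Type*} (F : Set (List α)) (O : List α) : Prop :=
  O ∉ F ∧ ∀ v : List α, v <:+: O → v ≠ O → v ∈ F

/-- All occurrences `(i, O)` of obstructions `O` for `F` in the finite word `t`, where `i` is the
starting position. -/
def obstructionOccurrences {α : Type*} (F : Set (List α)) (t : List α) : Set (ℕ × List α) :=
  {q | IsObstruction F q.2 ∧ ∃ x y : List α, t = x ++ q.2 ++ y ∧ x.length = q.1}

/-- The word `t` contains exactly one occurrence of an obstruction for `F`, and this occurrence is
at the beginning or at the end of `t`. -/
def HasOneObstruction {α : Type*} (F : Set (List α)) (t : List α) : Prop :=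
  ∃ (O : List α) (i : ℕ), (i = 0 ∨ i + O.length = t.length) ∧
    obstructionOccurrences F t = {(i, O)}

/-- The word `t` contains exactly two occurrences of obstructions for `F` (they may overlap); one
of them is at the beginning, the other at the end of `t`. -/
def HasTwoObstructions {α : Type*} (F : Set (List α)) (t : List α) : Prop :=
  ∃ (O₁ O₂ : List α) (i : ℕ), 0 < i ∧ i + O₂.length = t.length ∧
    obstructionOccurrences F t = {(0, O₁), (i, O₂)}

/-! ### The families of words -/

/-- All subwords of a family that consists of the finite words in `F` and the superwords in `S`. -/
def subwords {α : Type*} (F : Set (List α)) (S : Set (Superword α)) : Set (List α) :=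
  {w | (∃ t ∈ F, w <:+: t) ∨ (∃ W ∈ S, w ∈ W.factors)}

/-- The part of the family that is common to both cases: a finite set `μ` of finite words,
superwords `u_i^{∞/2} c_i` for `i < r₁`, superwords `d_i v_i^{∞/2}` for `i < r₂`, and words
`e_j R_j^k f_j` with `k ∈ K_j` for `j < r₃`. -/
structure CommonPart (α : Type*) where
  μ : Finset (List α)
  r₁ : ℕ
  u : Fin r₁ → NEWord α
  c : Fin r₁ → List α
  r₂ : ℕ
  d : Fin r₂ → List α
  v : Fin r₂ → NEWord α
  r₃ : ℕ
  e : Fin r₃ → List α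
  R : Fin r₃ → NEWord α
  f : Fin r₃ → List α
  K : Fin r₃ → Set ℕ

/-- The finite words of the common part. -/
def CommonPart.finiteWords {α : Type*} (B : CommonPart α) : Set (List α) :=
  {w | w ∈ B.μ} ∪ {w | ∃ j, ∃ k ∈ B.K j, w = B.e j ++ pow (B.R j).1 k ++ B.f j}

/-- The superwords of the common part. -/
def CommonPart.superwords {α : Type*} (B : CommonPart α) : Set (Superword α) :=
  {W | ∃ i, W = leftHalf (B.u i) (B.c i)} ∪ {W | ∃ i, W = rightHalf (B.d i) (B.v i)}

/-- The description in the first case: `L` is the set of subwords of the family that consists of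
the common part, of one word `u^{∞/2} c v^{∞/2}` that is not a shift of `u^∞`, and of a set `S` of
words `E u^n c v^m F` with `E`, `F` of bounded length, boundedly many of each length. -/
def CaseOne {α : Type*} (L : Set (List α)) : Prop :=
  ∃ (u v : NEWord α) (c : List α) (B : CommonPart α) (S : Set (List α)),
    (¬ ∃ t : ℤ, ∀ i : ℤ, biSeq u c v i = perBiSeq u (i + t)) ∧
    (∃ D : ℕ, ∀ w ∈ S, ∃ (E F : List α) (n m : ℕ), E.length ≤ D ∧ F.length ≤ D ∧
      w = E ++ pow u.1 n ++ c ++ pow v.1 m ++ F) ∧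
    (∃ C : ℕ, 0 < C ∧ ∀ k : ℕ, {w | w ∈ S ∧ w.length = k}.encard < (C : ℕ∞)) ∧
    L = subwords (B.finiteWords ∪ S) (B.superwords ∪ {Superword.two (biSeq u c v)})

/-- Words attaching one obstruction to a superword equivalent to `W`, to the right of the
obstruction: the superwords `P_i O_i W_i` for `i < n`. -/
structure RightAttached {α : Type*} (W : Superword α) where
  n : ℕ
  P : Fin n → List α
  O : Fin n → List α
  tail : Fin n → (ℕ → α)
  isObstruction : ∀ i, IsObstruction W.factors (O i)
  equivalent : ∀ i, (Superword.right (tail i)).Equivalent W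
  only : ∀ (i : Fin n) (Q : List α) (p : ℤ), IsObstruction W.factors Q →
    (Superword.right (prepend (O i) (tail i))).OccursAt Q p → p = 0 ∧ Q = O i

/-- The superwords `P_i O_i W_i`. -/
def RightAttached.superwords {α : Type*} {W : Superword α} (X : RightAttached W) :
    Set (Superword α) :=
  {Z | ∃ i, Z = Superword.right (prepend (X.P i ++ X.O i) (X.tail i))}

/-- Words attaching one obstruction to a superword equivalent to `W`, to the left of the
obstruction: the superwords `W'_j O'_j P'_j` for `j < n`. The letters of the left superword `W'_j`
are listed from right to left by `tail j`. -/
structure LeftAttached {α : Type*} (W : Superword α) where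
  n : ℕ
  P : Fin n → List α
  O : Fin n → List α
  tail : Fin n → (ℕ → α)
  isObstruction : ∀ i, IsObstruction W.factors (O i)
  equivalent : ∀ i, (Superword.left (tail i)).Equivalent W
  only : ∀ (i : Fin n) (Q : List α) (p : ℤ), IsObstruction W.factors Q →
    (Superword.left (prepend (O i).reverse (tail i))).OccursAt Q p →
      p = -((O i).length : ℤ) ∧ Q = O i

/-- The superwords `W'_j O'_j P'_j`. -/
def LeftAttached.superwords {α : Type*} {W : Superword α} (X : LeftAttached W) :
    Set (Superword α) :=
  {Z | ∃ i, Z = Superword.left (prepend (X.O i ++ X.P i).reverse (X.tail i))}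

/-- Finitely many series of words `h¹_i T h²_i` with `T ∈ 𝒯_i`, where every `T` contains one or two
obstructions for `W`. -/
structure ObstructionSeries {α : Type*} (W : Superword α) where
  n : ℕ
  h₁ : Fin n → List α
  h₂ : Fin n → List α
  T : Fin n → Set (List α)
  obstructions : ∀ i, ∀ t ∈ T i,
    HasOneObstruction W.factors t ∨ HasTwoObstructions W.factors t

/-- The words of the series. -/
def ObstructionSeries.words {α : Type*} {W : Superword α} (X : ObstructionSeries W) :
    Set (List α) :=
  {w | ∃ i, ∃ t ∈ X.T i, w = X.h₁ i ++ t ++ X.h₂ i}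

/-- The description in the second case, for the uniformly recurrent non-periodic superword `W`. -/
def CaseTwo {α : Type*} (L : Set (List α)) (W : Superword α) : Prop :=
  (∃ K N : ℕ, ∀ n : ℕ, N ≤ n → W.complexity n = n + K) ∧
  ∃ (B : CommonPart α) (X : RightAttached W) (Y : LeftAttached W) (Z : ObstructionSeries W),
    (∃ C : ℕ, 0 < C ∧ ∀ i, (Z.h₁ i).length + (Z.h₂ i).length < C) ∧
    (∃ m : ℕ, 0 < m ∧ ∀ k : ℕ,
      {w | w ∈ subwords Z.words ∅ ∧ w.length = k ∧ w ∉ W.factors}.encard ≤ (m : ℕ∞)) ∧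
    L = subwords (B.finiteWords ∪ Z.words)
      (B.superwords ∪ X.superwords ∪ Y.superwords ∪ {W})

end BoundaryAlgebra

namespace BoundaryAlgebra

/-! ### Windows of two-sided sequences -/

/-! Reducing a subword reduces the whole word, so the irreducible words form a language L closed
under subwords. Their values are a basis, hence `growthT` counts irreducible words of each length
(`growthT_eq`). What remains is a statement about factor-closed languages over a finite alphabet
with n + O(1) words of length n; the algebra plays no further role.

The main device is to split off a nonperiodic two-sided sequence x with all its subwords in L. By
Morse and Hedlund (`wordCount_lt_succ`) its complexity exceeds n and strictly increases. Being at
most n + C, it equals n + K for large n, and at most C words of each length in L are not subwords of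
x. Take a word of L and remove C letters at both ends. Either a subword of x remains, or C + 1 long
windows of the word all lie outside the language of x; then two of them coincide, and this gives a
short period, so the word is e R^k f with e, R, f bounded (`mem_powerWords_or_mem`).

In Case 2, x is chosen with the same subwords as W. If a word belongs to W up to bounded ends, all
its obstructions reach into these ends, and cutting at suitable ones leaves a word T with one or two
obstructions (`exists_obstruction_decomposition`). The sets K_j and 𝒯_i may be infinite, so the
lists of one-sided infinite words can be taken empty.

In Case 1 such an x comes from branching: two limit sequences agree on the negative positions and
differ at 0, so they cannot both be periodic (`exists_nonperiodic`). Its ends are periodic for the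
following reason. The limits of x far to the right contain a uniformly recurrent sequence y,
periodic by hypothesis. If x were not periodic far to the right, it would contain maximal runs of y
of unbounded length. But complexity growing by one leaves a single left special and a single right
special word of each length, and this excludes long maximal runs of two different lengths
(`run_length_unique`). Reflection treats the left end, so x has the form u^{∞/2} c v^{∞/2}. -/

/-- The finite word `x a, x (a+1), …, x (a+n-1)`. -/
def window {α : Type*} (x : ℤ → α) (a : ℤ) (n : ℕ) : List α :=
  List.ofFn fun j : Fin n => x (a + (j : ℕ))

/-- The set of finite subwords of a two-sided sequence. -/
def windows {α : Type*} (x : ℤ → α) : Set (List α) :=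
  {w | ∃ a n, w = window x a n}

/-- A set of words that contains all subwords of its members. -/
def FactorClosed {α : Type*} (F : Set (List α)) : Prop :=
  ∀ ⦃v w : List α⦄, v <:+: w → w ∈ F → v ∈ F

section Windows

variable {α : Type*} {x y : ℤ → α}

@[simp] lemma length_window (x : ℤ → α) (a : ℤ) (n : ℕ) : (window x a n).length = n := by
  simp [window]

lemma getElem_window (x : ℤ → α) (a : ℤ) (n j : ℕ) (h : j < (window x a n).length) :
    (window x a n)[j] = x (a + j) := by
  simp [window]

lemma window_eq_window_iff {a b : ℤ} {n : ℕ} :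
    window x a n = window y b n ↔ ∀ j : ℕ, j < n → x (a + j) = y (b + j) := by
  constructor
  · intro h j hj
    have := List.getElem_of_eq h (i := j) (by simpa using hj)
    simpa [getElem_window] using this
  · intro h
    apply List.ext_getElem (by simp)
    intro j h1 h2
    simpa [getElem_window] using h j (by simpa using h1)

lemma eq_window_iff {a : ℤ} {w : List α} :
    w = window x a w.length ↔ ∀ (j : ℕ) (h : j < w.length), w[j] = x (a + j) := by
  constructor
  · intro h j hj
    have := List.getElem_of_eq h hj
    rwa [getElem_window] at this
  · intro h
    apply List.ext_getElem (by simp)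
    intro j h1 h2
    rw [getElem_window, h]

lemma window_add (x : ℤ → α) (a : ℤ) (m n : ℕ) :
    window x a (m + n) = window x a m ++ window x (a + m) n := by
  simp [window, List.ofFn_add, add_assoc]

lemma window_zero (x : ℤ → α) (a : ℤ) : window x a 0 = [] := by simp [window]

lemma window_split (x : ℤ → α) {a b c : ℤ} (hab : a ≤ b) (hbc : b ≤ c) :
    window x a (c - a).toNat = window x a (b - a).toNat ++ window x b (c - b).toNat := by
  obtain ⟨m, rfl⟩ := Int.le.dest hab
  obtain ⟨n, rfl⟩ := Int.le.dest hbc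
  rw [show (a + m + n - a).toNat = m + n by omega, show (a + m - a).toNat = m by omega,
    show (a + m + n - (a + m)).toNat = n by omega, window_add]

lemma window_infix_window (x : ℤ → α) {a b : ℤ} {m n : ℕ} (h1 : b ≤ a) (h2 : a + m ≤ b + n) :
    window x a m <:+: window x b n := by
  obtain ⟨i, rfl⟩ := Int.le.dest h1
  obtain ⟨j, rfl⟩ : ∃ j : ℕ, n = i + m + j := ⟨n - (i + m), by omega⟩
  exact ⟨window x b i, window x (b + (i + m : ℕ)) j, by rw [window_add, window_add]⟩

lemma eq_window_of_append {b : ℤ} {n : ℕ} {s v t : List α} (h : window x b n = s ++ v ++ t) :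
    s.length + v.length ≤ n ∧ v = window x (b + s.length) v.length := by
  have hn : n = s.length + v.length + t.length := by simpa [add_assoc] using congrArg List.length h
  refine ⟨by omega, ?_⟩
  rw [hn, window_add, window_add] at h
  have h1 := (List.append_inj h (by simp)).1
  exact (List.append_inj h1 (by simp)).2.symm

lemma exists_eq_window_of_infix {v : List α} {b : ℤ} {n : ℕ} (h : v <:+: window x b n) :
    ∃ i : ℕ, i + v.length ≤ n ∧ v = window x (b + i) v.length := by
  obtain ⟨s, t, h⟩ := h
  exact ⟨s.length, eq_window_of_append h.symm⟩

lemma exists_eq_window [Nonempty α] (w : List α) : ∃ x : ℤ → α, w = window x 0 w.length := by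
  refine ⟨fun i => w.getD i.toNat (Classical.arbitrary α), eq_window_iff.2 fun j hj => ?_⟩
  simp [hj]

lemma window_mem_windows (x : ℤ → α) (a : ℤ) (n : ℕ) : window x a n ∈ windows x := ⟨a, n, rfl⟩

lemma factorClosed_windows (x : ℤ → α) : FactorClosed (windows x) := by
  rintro v w h ⟨a, n, rfl⟩
  obtain ⟨i, -, hi⟩ := exists_eq_window_of_infix h
  exact ⟨_, _, hi⟩

lemma factors_two (x : ℤ → α) : (Superword.two x).factors = windows x := by
  ext w
  constructor
  · rintro ⟨i, hi⟩
    refine ⟨i, w.length, eq_window_iff.2 fun j hj => ?_⟩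
    have := hi j hj
    simp only [Superword.letter, List.getElem?_eq_getElem hj, Option.some.injEq] at this
    exact this.symm
  · rintro ⟨a, n, rfl⟩
    refine ⟨a, fun j hj => ?_⟩
    rw [List.getElem?_eq_getElem hj, getElem_window]
    rfl

lemma factorClosed_factors (W : Superword α) : FactorClosed W.factors := by
  rintro v w ⟨s, t, rfl⟩ ⟨i, hi⟩
  refine ⟨i + s.length, fun j hj => ?_⟩
  have := hi (s.length + j) (by simp; omega)
  rw [Nat.cast_add, ← add_assoc] at this
  rw [this, List.append_assoc, List.getElem?_append_right (by omega),
    List.getElem?_append_left (by omega)]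
  simp

lemma exists_mem_factors_length (W : Superword α) (n : ℕ) : ∃ w ∈ W.factors, w.length = n := by
  cases W with
  | right f =>
    refine ⟨List.ofFn fun j : Fin n => f j, ⟨0, fun j hj => ?_⟩, by simp⟩
    rw [List.getElem?_eq_getElem hj]
    simp only [zero_add, List.getElem_ofFn]
    rfl
  | left f =>
    refine ⟨List.ofFn fun j : Fin n => f (n - 1 - j), ⟨-n, fun j hj => ?_⟩, by simp⟩
    rw [List.getElem?_eq_getElem hj]
    simp only [List.length_ofFn] at hj
    rw [show (-(n : ℤ) + j) = Int.negSucc (n - 1 - j) by omega]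
    simp [Superword.letter]
  | two f => exact ⟨window f 0 n, by rw [factors_two]; exact window_mem_windows _ _ _, by simp⟩

/-- A window of a sequence with local period `p` is a power. -/
lemma window_mul_eq_pow {a : ℤ} {p : ℕ} (k : ℕ)
    (h : ∀ i, a ≤ i → i + p < a + p * k → x (i + p) = x i) :
    window x a (p * k) = pow (window x a p) k := by
  induction k generalizing a with
  | zero => simp [window_zero, pow]
  | succ k ih =>
    rw [show p * (k + 1) = p + p * k by ring, window_add, pow, List.replicate_succ,
      List.flatten_cons, ← pow]
    congr 1
    rw [ih (a := a + p)]
    · rcases Nat.eq_zero_or_pos k with rfl | hk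
      · simp [pow]
      congr 1
      rw [window_eq_window_iff]
      intro j hj
      rw [← h (a + j) (by omega)]
      · congr 1; ring
      · push_cast
        have : (p : ℤ) ≤ p * k := by exact_mod_cast Nat.le_mul_of_pos_right p hk
        nlinarith
    · intro i h1 h2
      apply h i (by omega)
      push_cast
      linarith

/-- A periodic stretch is a power followed by a short word. -/
lemma exists_pow_append {a : ℤ} {p n : ℕ}
    (h : ∀ i, a ≤ i → i + p < a + n → x (i + p) = x i) :
    window x a n = pow (window x a p) (n / p) ++ window x (a + (p * (n / p) : ℕ)) (n % p) := by
  conv_lhs => rw [← Nat.div_add_mod n p, window_add]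
  rw [window_mul_eq_pow]
  intro i h1 h2
  apply h i h1
  have : p * (n / p) ≤ n := Nat.mul_div_le n p
  have : ((p * (n / p) : ℕ) : ℤ) ≤ n := by exact_mod_cast this
  push_cast at this h2
  linarith

end Windows

/-! ### Compactness -/

open Filter in
/-- Ultralimits of sequences in a finite alphabet. -/
lemma exists_ultralimit {α : Type*} [Finite α] (g : ℕ → ℤ → α) :
    ∃ x : ℤ → α, ∀ i, ∀ᶠ n in (hyperfilter ℕ : Filter ℕ), g n i = x i := by
  have : ∀ i, ∃ c, ∀ᶠ n in (hyperfilter ℕ : Filter ℕ), g n i = c := by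
    intro i
    have := (Ultrafilter.eventually_exists_iff (f := hyperfilter ℕ)
      (P := fun (c : α) (n : ℕ) => g n i = c)).1 (Eventually.of_forall fun n => ⟨_, rfl⟩)
    exact this
  choose x hx using this
  exact ⟨x, hx⟩

open Filter in
/-- Infinitely many members of a sequence agree with the ultralimit on a given window. -/
lemma exists_agree {α : Type*} {g : ℕ → ℤ → α} {x : ℤ → α}
    (h : ∀ i, ∀ᶠ n in (hyperfilter ℕ : Filter ℕ), g n i = x i) (a : ℤ) (m N : ℕ) :
    ∃ n, N ≤ n ∧ ∀ j : ℕ, j < m → g n (a + j) = x (a + j) := by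
  have h1 : ∀ᶠ n in (hyperfilter ℕ : Filter ℕ), N ≤ n :=
    Nat.hyperfilter_le_atTop (eventually_ge_atTop N)
  have h2 : ∀ᶠ n in (hyperfilter ℕ : Filter ℕ), ∀ j ∈ Finset.range m, g n (a + j) = x (a + j) :=
    (Finset.eventually_all _).2 fun j _ => h _
  obtain ⟨n, hn1, hn2⟩ := (h1.and h2).exists
  exact ⟨n, hn1, fun j hj => hn2 j (Finset.mem_range.2 hj)⟩

/-- A factor-closed language with words of all lengths contains all subwords of some two-sided
sequence. -/
lemma exists_windows_subset {α : Type*} [Finite α] {F : Set (List α)} (hF : FactorClosed F)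
    (hlen : ∀ n, ∃ w ∈ F, w.length = n) : ∃ x : ℤ → α, windows x ⊆ F := by
  have : Nonempty α := by
    obtain ⟨w, -, hw⟩ := hlen 1
    exact ⟨w[0]⟩
  have hg : ∀ n : ℕ, ∃ g : ℤ → α, window g (-n) (2 * n) ∈ F := by
    intro n
    obtain ⟨w, hw, hl⟩ := hlen (2 * n)
    obtain ⟨y, hy⟩ := exists_eq_window w
    -- The word is centred at 0, so every fixed window is covered once n is large.
    refine ⟨fun i => y (i + n), ?_⟩
    convert hw using 1
    rw [hy, hl, window_eq_window_iff]
    intro j _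
    congr 1
    ring
  choose g hg using hg
  obtain ⟨x, hx⟩ := exists_ultralimit g
  refine ⟨x, ?_⟩
  rintro w ⟨a, m, rfl⟩
  obtain ⟨n, hn, h⟩ := exists_agree hx a m (a.natAbs + m)
  rw [← window_eq_window_iff] at h
  rw [← h]
  exact hF (window_infix_window _ (by omega) (by push_cast; omega)) (hg n)

/-- A nonempty chain of sets of words, each with words of length `n`, has a common word of
length `n`. -/
lemma exists_mem_sInter_of_isChain {α : Type*} [Finite α] {c : Set (Set (List α))}
    (hc : IsChain (· ⊆ ·) c) (hne : c.Nonempty) {n : ℕ}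
    (h : ∀ F ∈ c, ∃ w ∈ F, w.length = n) : ∃ w ∈ ⋂₀ c, w.length = n := by
  by_contra! hcon
  have hfin : {w : List α | w.length = n}.Finite := List.finite_length_eq α n
  have h1 : ∀ w : List α, ∃ F ∈ c, w.length = n → w ∉ F := by
    intro w
    by_cases hw : w.length = n
    · by_contra! h'
      exact hcon w (fun F hF => (h' F hF).2) hw
    · exact ⟨_, hne.choose_spec, fun h => absurd h hw⟩
  choose G hG1 hG2 using h1
  -- Each of the finitely many words of length n is missing from some member of the chain; the
  -- smallest of these members misses them all.
  have key : ∀ s : Finset (List α), ∃ F ∈ c, ∀ w ∈ s, F ⊆ G w := by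
    intro s
    classical
    induction s using Finset.induction_on with
    | empty => exact ⟨_, hne.choose_spec, by simp⟩
    | insert a s _ ih =>
      obtain ⟨F, hF, hs⟩ := ih
      rcases hc.total hF (hG1 a) with h | h
      · exact ⟨F, hF, by simpa using ⟨h, hs⟩⟩
      · exact ⟨G a, hG1 a, by simpa using fun w hw => h.trans (hs w hw)⟩
  obtain ⟨F, hF, hs⟩ := key hfin.toFinset
  obtain ⟨w, hw, hl⟩ := h F hF
  exact hG2 w hl (hs w (by simpa using hl) hw)

/-- Every factor-closed language with words of all lengths contains the subwords of a uniformly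
recurrent two-sided sequence. -/
lemma exists_uniformlyRecurrent {α : Type*} [Finite α] {F : Set (List α)} (hF : FactorClosed F)
    (hlen : ∀ n, ∃ w ∈ F, w.length = n) :
    ∃ y : ℤ → α, windows y ⊆ F ∧ (Superword.two y).UniformlyRecurrent := by
  obtain ⟨M, hMF, hM⟩ := zorn_superset_nonempty
    {M : Set (List α) | FactorClosed M ∧ ∀ n, ∃ w ∈ M, w.length = n} (by
      intro c hcS hc hne
      refine ⟨⋂₀ c, ⟨?_, fun n => ?_⟩, fun s hs => Set.sInter_subset_of_mem hs⟩
      · exact fun v w hvw hw G hG => (hcS hG).1 hvw (hw G hG)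
      · exact exists_mem_sInter_of_isChain hc hne fun G hG => (hcS hG).2 n)
    F ⟨hF, hlen⟩
  obtain ⟨hMc, hMl⟩ := hM.prop
  obtain ⟨y, hy⟩ := exists_windows_subset hMc hMl
  have hrec : ∀ v ∈ M, ∃ N : ℕ, ∀ u ∈ M, N ≤ u.length → v <:+: u := by
    intro v hv
    by_contra! hcon
    -- If arbitrarily long words of M avoid v, those avoiding v form a smaller admissible language,
    -- against minimality.
    have hmem : {w ∈ M | ¬ v <:+: w} ∈
        {M : Set (List α) | FactorClosed M ∧ ∀ n, ∃ w ∈ M, w.length = n} := by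
      constructor
      · rintro p q hpq ⟨hq, hvq⟩
        exact ⟨hMc hpq hq, fun h => hvq (h.trans hpq)⟩
      · intro n
        obtain ⟨u, hu, hn, hvu⟩ := hcon n
        refine ⟨u.take n, ⟨hMc (List.take_prefix n u).isInfix hu, fun h => hvu ?_⟩, by simpa⟩
        exact h.trans (List.take_prefix n u).isInfix
    exact (hM.le_of_le hmem (fun w hw => hw.1) hv).2 (List.infix_refl v)
  refine ⟨y, hy.trans hMF, ?_, ?_⟩
  · intro v hv N
    rw [factors_two] at hv
    obtain ⟨n, hn⟩ := hrec v (hy hv)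
    -- Every window of length n contains v, so v occurs with bounded gaps in both directions.
    have key : ∀ b : ℤ, ∃ i, b ≤ i ∧ i ≤ b + n ∧ (Superword.two y).OccursAt v i := by
      intro b
      obtain ⟨i, hi1, hi2⟩ :=
        exists_eq_window_of_infix (hn _ (hy (window_mem_windows y b n)) (by simp))
      refine ⟨b + i, by omega, by omega, fun j hj => ?_⟩
      rw [List.getElem?_eq_getElem hj, eq_window_iff.1 hi2 j hj]
      rfl
    obtain ⟨i, hi, -, hi'⟩ := key N
    obtain ⟨j, -, hj, hj'⟩ := key (N - n)
    exact ⟨⟨i, hi, hi'⟩, ⟨j, by omega, hj'⟩⟩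
  · rw [factors_two]
    intro v hv
    obtain ⟨n, hn⟩ := hrec v (hy hv)
    exact ⟨n, fun u hu => hn u (hy hu)⟩

/-! ### Complexity of two-sided sequences -/

/-- The number of words of length `n` in a language. -/
noncomputable def wordCount {α : Type*} (F : Set (List α)) (n : ℕ) : ℕ :=
  Set.ncard {w : List α | w ∈ F ∧ w.length = n}

lemma finite_words {α : Type*} [Finite α] (F : Set (List α)) (n : ℕ) :
    {w : List α | w ∈ F ∧ w.length = n}.Finite :=
  (List.finite_length_eq α n).subset fun _ h => h.2

/-- A surjection onto a set with one element less is injective up to one element. -/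
lemma exists_injOn_of_surjOn {β γ : Type*} {S : Set β} {T : Set γ} {f : β → γ} {d : ℕ}
    (hS : S.Finite) (hf : Set.SurjOn f S T) (h : S.ncard ≤ T.ncard + d) :
    ∃ G ⊆ S, Set.InjOn f G ∧ (S \ G).ncard ≤ d := by
  obtain ⟨G, hGS, hG⟩ := hf.exists_bijOn_subset
  refine ⟨G, hGS, hG.injOn, ?_⟩
  have h1 : G.ncard = T.ncard := by
    rw [← hG.image_eq, hG.injOn.ncard_image]
  have := Set.ncard_sdiff_add_ncard_of_subset hGS hS
  omega

section Complexity

variable {α : Type*} {x : ℤ → α}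

lemma take_window (x : ℤ → α) (a : ℤ) (n : ℕ) : (window x a (n + 1)).take n = window x a n := by
  rw [window_add, List.take_left' (by simp)]

lemma drop_window (x : ℤ → α) (a : ℤ) (n : ℕ) :
    (window x (a - 1) (n + 1)).drop 1 = window x a n := by
  rw [add_comm n 1, window_add, List.drop_left' (by simp)]
  simp

/-- Keep one right extension of each word of length `n`: the kept words have distinct prefixes, and
the number left over is the growth of the complexity. A right special word must have an extension
outside `G`. -/
lemma exists_right_injOn [Finite α] {n d : ℕ}
    (h : wordCount (windows x) (n + 1) ≤ wordCount (windows x) n + d) :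
    ∃ G : Set (List α), Set.InjOn (List.take n) G ∧
      ({w | w ∈ windows x ∧ w.length = n + 1} \ G).ncard ≤ d := by
  obtain ⟨G, -, h1, h2⟩ := exists_injOn_of_surjOn (f := List.take n) (finite_words _ _)
    (T := {w | w ∈ windows x ∧ w.length = n}) (by
      rintro w ⟨⟨a, m, rfl⟩, hm⟩
      obtain rfl : m = n := by simpa using hm
      exact ⟨window x a (m + 1), ⟨window_mem_windows _ _ _, by simp⟩, take_window _ _ _⟩) h
  exact ⟨G, h1, h2⟩

lemma exists_left_injOn [Finite α] {n d : ℕ}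
    (h : wordCount (windows x) (n + 1) ≤ wordCount (windows x) n + d) :
    ∃ G : Set (List α), Set.InjOn (List.drop 1) G ∧
      ({w | w ∈ windows x ∧ w.length = n + 1} \ G).ncard ≤ d := by
  obtain ⟨G, -, h1, h2⟩ := exists_injOn_of_surjOn (f := List.drop 1) (finite_words _ _)
    (T := {w | w ∈ windows x ∧ w.length = n}) (by
      rintro w ⟨⟨a, m, rfl⟩, hm⟩
      obtain rfl : m = n := by simpa using hm
      exact ⟨window x (a - 1) (m + 1), ⟨window_mem_windows _ _ _, by simp⟩, drop_window _ _ _⟩) h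
  exact ⟨G, h1, h2⟩

lemma eq_of_ncard_diff_le_one [Finite α] {G : Set (List α)} {n : ℕ}
    (h : ({w | w ∈ windows x ∧ w.length = n} \ G).ncard ≤ 1) {a b : ℤ}
    (ha : window x a n ∉ G) (hb : window x b n ∉ G) : window x a n = window x b n :=
  (Set.ncard_le_one ((finite_words _ _).subset Set.sdiff_subset)).1 h _
    ⟨⟨window_mem_windows _ _ _, by simp⟩, ha⟩ _ ⟨⟨window_mem_windows _ _ _, by simp⟩, hb⟩

lemma letter_right_eq {a b : ℤ} {n : ℕ} (h : window x a (n + 1) = window x b (n + 1)) :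
    x (a + n) = x (b + n) := window_eq_window_iff.1 h n (by omega)

lemma letter_left_eq {a b : ℤ} {n : ℕ} (h : window x (a - 1) (n + 1) = window x (b - 1) (n + 1)) :
    x (a - 1) = x (b - 1) := by simpa using window_eq_window_iff.1 h 0 (by omega)

/-- Right special words of a given length are unique if the complexity grows by at most one. -/
lemma right_special_unique [Finite α] {n : ℕ}
    (h : wordCount (windows x) (n + 1) ≤ wordCount (windows x) n + 1) {a a' b b' : ℤ}
    (ha : window x a n = window x a' n) (ha' : x (a + n) ≠ x (a' + n))
    (hb : window x b n = window x b' n) (hb' : x (b + n) ≠ x (b' + n)) :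
    window x a n = window x b n := by
  obtain ⟨G, hG, hc⟩ := exists_right_injOn h
  have key : ∀ a a' : ℤ, window x a n = window x a' n → x (a + n) ≠ x (a' + n) →
      ∃ e, window x e n = window x a n ∧ window x e (n + 1) ∉ G := by
    intro a a' ha ha'
    by_contra! hcon
    exact ha' (letter_right_eq (hG (hcon a rfl) (hcon a' ha.symm)
      (by rw [take_window, take_window, ha])))
  obtain ⟨e, he, heG⟩ := key a a' ha ha'
  obtain ⟨e', he', heG'⟩ := key b b' hb hb'
  rw [← he, ← he', ← take_window, eq_of_ncard_diff_le_one hc heG heG', take_window]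

/-- Two different left extensions of one word have the same tail, so `G` contains at most one of
them. -/
lemma exists_left_extension {n : ℕ} {G : Set (List α)} (hG : Set.InjOn (List.drop 1) G) (a a' : ℤ)
    (ha : window x a n = window x a' n) (ha' : x (a - 1) ≠ x (a' - 1)) :
    ∃ e, (e = a ∨ e = a') ∧ window x e n = window x a n ∧ window x (e - 1) (n + 1) ∉ G := by
  by_contra! hcon
  exact ha' (letter_left_eq (hG (hcon a (.inl rfl) rfl) (hcon a' (.inr rfl) ha.symm)
    (by rw [drop_window, drop_window, ha])))

/-- Left special words of a given length are unique if the complexity grows by at most one. -/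
lemma left_special_unique [Finite α] {n : ℕ}
    (h : wordCount (windows x) (n + 1) ≤ wordCount (windows x) n + 1) {a a' b b' : ℤ}
    (ha : window x a n = window x a' n) (ha' : x (a - 1) ≠ x (a' - 1))
    (hb : window x b n = window x b' n) (hb' : x (b - 1) ≠ x (b' - 1)) :
    window x a n = window x b n := by
  obtain ⟨G, hG, hc⟩ := exists_left_injOn h
  obtain ⟨e, -, he, heG⟩ := exists_left_extension hG a a' ha ha'
  obtain ⟨e', -, he', heG'⟩ := exists_left_extension hG b b' hb hb'
  rw [← he, ← he', ← drop_window, eq_of_ncard_diff_le_one hc heG heG', drop_window]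

/-- A left special word has exactly two left extensions if the complexity grows by at most one. -/
lemma left_extensions_le_two [Finite α] {n : ℕ}
    (h : wordCount (windows x) (n + 1) ≤ wordCount (windows x) n + 1) {a b c : ℤ}
    (hac : window x a n = window x c n) (hac' : x (a - 1) ≠ x (c - 1))
    (hbc : window x b n = window x c n) (hbc' : x (b - 1) ≠ x (c - 1)) :
    x (a - 1) = x (b - 1) := by
  obtain ⟨G, hG, hc⟩ := exists_left_injOn h
  by_contra hab
  have key : ∀ a a', window x a n = window x a' n → x (a - 1) ≠ x (a' - 1) →
    window x (a - 1) (n + 1) ∉ G → window x (a' - 1) (n + 1) ∉ G → False := fun a a' _ h2 h3 h4 =>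
      h2 (letter_left_eq (eq_of_ncard_diff_le_one hc h3 h4))
  -- Each pair among three different extensions has a member outside `G`, so at least two extensions
  -- lie there, one too many.
  obtain ⟨e, he, -, heG⟩ := exists_left_extension hG a c hac hac'
  obtain ⟨f, hf, -, hfG⟩ := exists_left_extension hG b c hbc hbc'
  obtain ⟨g, hg, -, hgG⟩ := exists_left_extension hG a b (hac.trans hbc.symm) hab
  have h1 := letter_left_eq (eq_of_ncard_diff_le_one hc heG hfG)
  have h2 := letter_left_eq (eq_of_ncard_diff_le_one hc heG hgG)
  rcases he with rfl | rfl <;> rcases hf with rfl | rfl <;> rcases hg with rfl | rfl <;> simp_all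

/-- The theorem of Morse and Hedlund for two-sided sequences. -/
lemma wordCount_lt_succ [Finite α] (hx : ¬ (Superword.two x).Periodic) (n : ℕ) :
    wordCount (windows x) n < wordCount (windows x) (n + 1) := by
  by_contra! hle
  apply hx
  -- Without growth nothing lies outside `G` and `G'`: every word of length n determines the letters
  -- on both of its sides. One repeated window then forces a period in both directions.
  obtain ⟨G, hG, hc⟩ := exists_right_injOn (d := 0) hle
  obtain ⟨G', hG', hc'⟩ := exists_left_injOn (d := 0) hle
  have hmem : ∀ {G : Set (List α)}, ({w | w ∈ windows x ∧ w.length = n + 1} \ G).ncard ≤ 0 →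
      ∀ a, window x a (n + 1) ∈ G := by
    intro G hc a
    by_contra hcon
    rw [Nat.le_zero, Set.ncard_eq_zero ((finite_words _ _).subset Set.sdiff_subset)] at hc
    have : window x a (n + 1) ∈ ({w | w ∈ windows x ∧ w.length = n + 1} \ G) :=
      ⟨⟨window_mem_windows _ _ _, by simp⟩, hcon⟩
    simp [hc] at this
  have hright : ∀ a b, window x a n = window x b n → window x (a + 1) n = window x (b + 1) n := by
    intro a b hab
    have := hG (hmem hc a) (hmem hc b) (by rw [take_window, take_window, hab])
    have h1 := drop_window x (a + 1) n
    have h2 := drop_window x (b + 1) n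
    rw [add_sub_cancel_right] at h1 h2
    rw [← h1, ← h2, this]
  have hleft : ∀ a b, window x a n = window x b n → x (a - 1) = x (b - 1) ∧
      window x (a - 1) n = window x (b - 1) n := by
    intro a b hab
    have := hG' (hmem hc' (a - 1)) (hmem hc' (b - 1)) (by rw [drop_window, drop_window, hab])
    exact ⟨letter_left_eq this, by rw [← take_window, this, take_window]⟩
  obtain ⟨i, j, hij, h⟩ : ∃ i j : ℤ, i < j ∧ window x i n = window x j n := by
    have : ¬ Function.Injective fun i : ℤ =>
        (⟨window x i n, by simp⟩ : {l : List α | l.length = n}) := by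
      have : Finite {l : List α | l.length = n} := List.finite_length_eq α n
      exact not_injective_infinite_finite _
    simp only [Function.Injective, not_forall] at this
    obtain ⟨i, j, h, hne⟩ := this
    simp only [Subtype.mk.injEq] at h
    rcases lt_or_gt_of_ne hne with h' | h'
    · exact ⟨i, j, h', h⟩
    · exact ⟨j, i, h', h.symm⟩
  have hr : ∀ k : ℕ, window x (i + k) n = window x (j + k) n := by
    intro k
    induction k with
    | zero => simpa using h
    | succ k ih => simpa [add_assoc] using hright _ _ ih
  have hl : ∀ k : ℕ, ∀ a b, window x a n = window x b n →
      window x (a - k) n = window x (b - k) n := by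
    intro k
    induction k with
    | zero => simp
    | succ k ih =>
      intro a b hab
      have := (hleft _ _ (ih a b hab)).2
      push_cast
      rwa [← sub_sub, ← sub_sub]
  refine ⟨(j - i).toNat, by omega, fun m => ?_⟩
  by_cases hm : m < i
  · have h1 := (hleft _ _ (hl (i - m - 1).toNat _ _ h)).1
    rw [show i - ((i - m - 1).toNat : ℤ) - 1 = m by omega,
      show j - ((i - m - 1).toNat : ℤ) - 1 = m + ((j - i).toNat : ℤ) by omega] at h1
    exact h1.symm
  · have h1 := (hleft _ _ (hr (m - i + 1).toNat)).1
    rw [show i + ((m - i + 1).toNat : ℤ) - 1 = m by omega,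
      show j + ((m - i + 1).toNat : ℤ) - 1 = m + ((j - i).toNat : ℤ) by omega] at h1
    exact h1.symm

lemma lt_wordCount [Finite α] (hx : ¬ (Superword.two x).Periodic) (n : ℕ) : n < wordCount (windows x) n := by
  induction n with
  | zero =>
    refine (Set.ncard_pos (finite_words _ _)).2 ⟨[], ⟨0, 0, by simp [window_zero]⟩, rfl⟩
  | succ n ih => have := wordCount_lt_succ hx n; omega

/-- A nonperiodic sequence whose complexity exceeds `n` by a bounded amount has complexity `n + K`
for large `n`. -/
lemma exists_wordCount_eq [Finite α] (hx : ¬ (Superword.two x).Periodic) {C : ℕ}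
    (hC : ∀ n, wordCount (windows x) n ≤ n + C) :
    ∃ K N : ℕ, ∀ n, N ≤ n → wordCount (windows x) n = n + K := by
  -- The excess over n is nondecreasing and bounded, hence eventually constant.
  have hmono : Monotone fun n => wordCount (windows x) n - n := monotone_nat_of_le_succ fun n => by
    have := wordCount_lt_succ hx n
    omega
  obtain ⟨N, hN⟩ : ∃ N, ∀ m, wordCount (windows x) m - m ≤ wordCount (windows x) N - N := by
    have hfin : (Set.range fun n => wordCount (windows x) n - n).Finite :=
      (Set.finite_Iic C).subset (by rintro _ ⟨n, rfl⟩; have := hC n; simp only [Set.mem_Iic]; omega)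
    obtain ⟨_, ⟨N, rfl⟩, hN⟩ := hfin.exists_maximal ⟨_, 0, rfl⟩
    refine ⟨N, fun m => ?_⟩
    by_contra! hlt
    have := hN ⟨m, rfl⟩ hlt.le
    simp only at this
    omega
  refine ⟨wordCount (windows x) N - N, N, fun n hn => ?_⟩
  have h1 := hmono hn
  have h2 := hN n
  have := lt_wordCount hx n
  simp only at h1
  omega

end Complexity

/-! ### Runs of a periodic sequence -/

section Runs

variable {α : Type*} {x y : ℤ → α} {p : ℕ}

/-- Agreement along one full period fixes the phase. -/
lemma periodic_shift_eq (hp : 0 < p) (hy : Function.Periodic y (p : ℤ)) {u v : ℤ}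
    (h : ∀ j : ℕ, j < p → y (u + j) = y (v + j)) (j : ℤ) : y (u + j) = y (v + j) := by
  have key : ∀ u, y (u + j) = y (u + (j % p).toNat) := by
    intro u
    have h1 := hy.int_mul (j / p) (u + j % p)
    have h2 := Int.emod_nonneg j (b := p) (by omega)
    rw [Int.toNat_of_nonneg h2, ← h1, add_assoc]
    congr 2
    simp only [Int.cast_id]
    rw [mul_comm, Int.emod_add_mul_ediv]
  rw [key u, key v]
  apply h
  have := Int.emod_lt_of_pos j (b := p) (by omega)
  omega

/-- If the complexity grows by at most one, there are no maximal runs of a periodic sequence of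
two different large lengths. -/
lemma run_length_unique [Finite α] (hp : 0 < p) (hy : Function.Periodic y (p : ℤ)) {n₀ : ℕ}
    (hcount : ∀ n, n₀ ≤ n → wordCount (windows x) (n + 1) ≤ wordCount (windows x) n + 1)
    (hyx : windows y ⊆ windows x) {a t a' t' : ℤ} {n n' : ℕ} (hn : n₀ ≤ n) (hpn : p ≤ n)
    (hnn : n < n') (h : ∀ j, a ≤ j → j < a + n → x j = y (j + t)) (hl : x (a - 1) ≠ y (a - 1 + t))
    (hr : x (a + n) ≠ y (a + n + t))
    (h' : ∀ j, a' ≤ j → j < a' + n' → x j = y (j + t')) (hl' : x (a' - 1) ≠ y (a' - 1 + t'))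
    (hr' : x (a' + n') ≠ y (a' + n' + t')) : False := by
  have hex : ∀ (b : ℤ) (m : ℕ), ∃ e : ℤ, ∀ j : ℤ, e ≤ j → j < e + m → x j = y (j - e + b) := by
    intro b m
    obtain ⟨e, m', he⟩ := hyx (window_mem_windows y b m)
    obtain rfl : m = m' := by simpa using congrArg List.length he
    refine ⟨e, fun j h1 h2 => ?_⟩
    have := window_eq_window_iff.1 he (j - e).toNat (by omega)
    rw [Int.toNat_of_nonneg (by omega)] at this
    rw [show j = e + (j - e) by ring, ← this]
    congr 1
    ring
  -- An occurrence in `x` of the run prolonged by one letter of `y` on each side. Compared with the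
  -- maximal run, it makes the word of the run both left and right special.
  obtain ⟨e, he⟩ := hex (a + t - 1) (n + 2)
  obtain ⟨f, hf⟩ := hex (a' + t' - 1) (n' + 2)
  have hB : window x (e + 1) n = window x a n := by
    rw [window_eq_window_iff]
    intro j hj
    rw [he _ (by omega) (by push_cast; omega), h _ (by omega) (by omega)]
    congr 1; ring
  have hx_e : x e = y (a - 1 + t) := by
    rw [he e le_rfl (by omega)]; congr 1; ring
  have hx_e' : x (e + 1 + n) = y (a + n + t) := by
    rw [he _ (by omega) (by push_cast; omega)]; congr 1; ring
  have hF : window x (f + 1) n = window x a' n := by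
    rw [window_eq_window_iff]
    intro j hj
    rw [hf _ (by omega) (by push_cast; omega), h' _ (by omega) (by omega)]
    congr 1; ring
  have hx_f : x f = y (a' - 1 + t') := by
    rw [hf f le_rfl (by omega)]; congr 1; ring
  have hx_f' : x (f + 1 + n') = y (a' + n' + t') := by
    rw [hf _ (by omega) (by push_cast; omega)]; congr 1; ring
  set m : ℤ := a' + n' - n with hm
  have hF' : window x (f + 1 + n' - n) n = window x m n := by
    rw [window_eq_window_iff]
    intro j hj
    rw [hf _ (by omega) (by push_cast; omega), h' _ (by omega) (by omega)]
    congr 1; rw [hm]; ring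
  have hc := hcount n hn
  -- The first n letters of the long run are left special and its last n letters right special, so
  -- by uniqueness both equal the short run, with the same phase of `y`.
  have e1 : window x a' n = window x a n :=
    left_special_unique hc hF.symm (by rw [add_sub_cancel_right, hx_f]; exact hl')
      hB.symm (by rw [add_sub_cancel_right, hx_e]; exact hl)
  have e2 : window x m n = window x a n := by
    refine right_special_unique hc hF'.symm ?_ hB.symm (by rw [hx_e']; exact hr)
    rw [show f + 1 + n' - n + n = f + 1 + (n' : ℤ) by ring, hx_f',
      show m + n = a' + n' by rw [hm]; ring]
    exact hr'
  have p1 : ∀ j, y (a' + t' + j) = y (a + t + j) := by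
    apply periodic_shift_eq hp hy
    intro j hj
    have := window_eq_window_iff.1 e1 j (by omega)
    rw [h (a + j) (by omega) (by omega), h' (a' + j) (by omega) (by omega)] at this
    rwa [add_right_comm, add_right_comm a t]
  have p2 : ∀ j, y (m + t' + j) = y (a + t + j) := by
    apply periodic_shift_eq hp hy
    intro j hj
    have := window_eq_window_iff.1 e2 j (by omega)
    rw [h (a + j) (by omega) (by omega), h' (m + j) (by omega) (by omega)] at this
    rwa [add_right_comm, add_right_comm a t]
  -- Besides the letter continuing `y`, only one other left extension is possible, so both runs are
  -- preceded by the same letter.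
  have e3 : x (a - 1) = x (a' - 1) := by
    refine left_extensions_le_two hc (c := e + 1) hB.symm ?_ (e1.trans hB.symm) ?_
    · rwa [add_sub_cancel_right, hx_e]
    · rw [add_sub_cancel_right, hx_e, show a - 1 + t = a + t + -1 by ring, ← p1,
        show a' + t' + -1 = a' - 1 + t' by ring]
      exact hl'
  -- Two right special words of length n + 1. The left one starts with the mismatch before the runs,
  -- and only the longer run goes on following `y`; the right one follows `y` throughout, and only
  -- the end of the longer run breaks off after it. Their equality contradicts the mismatch in the
  -- first letter.
  have key : window x (a - 1) (n + 1) = window x e (n + 1) := by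
    refine right_special_unique (hcount (n + 1) (by omega)) (a' := a' - 1) (b' := m - 1) ?_ ?_ ?_ ?_
    · rw [add_comm n 1, window_add, window_add]
      congr 1
      · simp [window, e3]
      · simpa using e1.symm
    · push_cast
      rw [show a - 1 + (n + 1) = a + (n : ℤ) by ring, show a' - 1 + (n + 1) = a' + (n : ℤ) by ring,
        h' (a' + n) (by omega) (by omega), add_right_comm a', p1, add_right_comm a]
      exact hr
    · rw [window_eq_window_iff]
      intro j hj
      rw [he _ (by omega) (by push_cast; omega), h' _ (by omega) (by omega),
        show m - 1 + (j : ℤ) + t' = m + t' + (j - 1) by ring, p2]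
      congr 1; ring
    · push_cast
      rw [show m - 1 + (n + 1) = a' + (n' : ℤ) by rw [hm]; ring,
        show e + (n + 1) = e + 1 + (n : ℤ) by ring, hx_e', add_right_comm, ← p2,
        show m + t' + n = a' + n' + t' by rw [hm]; ring]
      exact hr'.symm
  have := window_eq_window_iff.1 key 0 (by omega)
  simp only [Nat.cast_zero, add_zero, hx_e] at this
  exact hl this

/-- A sequence whose complexity grows by at most one and that approximates a periodic sequence far
to the right is periodic from some point on. -/
lemma eventually_periodic [Finite α] (hp : 0 < p) (hy : Function.Periodic y (p : ℤ)) {n₀ : ℕ}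
    (hcount : ∀ n, n₀ ≤ n → wordCount (windows x) (n + 1) ≤ wordCount (windows x) n + 1)
    (hyx : ∀ (b : ℤ) (n : ℕ) (N : ℤ), ∃ a, N ≤ a ∧ window x a n = window y b n) :
    ∃ i₀ : ℤ, ∀ i, i₀ ≤ i → x (i + p) = x i := by
  by_contra! hcon
  have hrun : ∀ l : ℕ, ∃ (a t : ℤ) (n : ℕ), l ≤ n ∧ (∀ j, a ≤ j → j < a + n → x j = y (j + t)) ∧
      x (a - 1) ≠ y (a - 1 + t) ∧ x (a + n) ≠ y (a + n + t) := by
    intro l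
    obtain ⟨i, -, hi⟩ := hcon 0
    -- The match starts beyond i + p, so the failure of the period at i yields a mismatch to its
    -- left.
    obtain ⟨a₀, ha₀, hw⟩ := hyx 0 l (i + p + 1)
    have hw' : ∀ j, a₀ ≤ j → j < a₀ + l → x j = y (j + -a₀) := by
      intro j h1 h2
      have := window_eq_window_iff.1 hw (j - a₀).toNat (by omega)
      rw [Int.toNat_of_nonneg (by omega)] at this
      rw [show j = a₀ + (j - a₀) by ring, this]
      congr 1; ring
    obtain ⟨i', hi'a, hi'⟩ := hcon a₀
    have hmis : ∀ i, x (i + p) ≠ x i → x i ≠ y (i + -a₀) ∨ x (i + p) ≠ y (i + p + -a₀) := by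
      intro i hi
      by_contra! h
      apply hi
      rw [h.1, h.2, add_right_comm]
      exact hy _
    obtain ⟨b, ⟨hb1, hb2⟩, hb3⟩ := Int.exists_greatest_of_bdd
      (P := fun j => j < a₀ ∧ x j ≠ y (j + -a₀)) ⟨a₀, fun z hz => hz.1.le⟩ (by
        rcases hmis i hi with h | h
        · exact ⟨i, by omega, h⟩
        · exact ⟨i + p, by omega, h⟩)
    obtain ⟨c, ⟨hc1, hc2⟩, hc3⟩ := Int.exists_least_of_bdd
      (P := fun j => a₀ ≤ j ∧ x j ≠ y (j + -a₀)) ⟨a₀, fun z hz => hz.1⟩ (by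
        rcases hmis i' hi' with h | h
        · exact ⟨i', by omega, h⟩
        · exact ⟨i' + p, by omega, h⟩)
    have hcl : a₀ + l ≤ c := by
      by_contra! h
      exact hc2 (hw' c hc1 h)
    refine ⟨b + 1, -a₀, (c - (b + 1)).toNat, by omega, ?_, by simpa using hb2, ?_⟩
    · intro j h1 h2
      by_contra hne
      rcases lt_or_ge j a₀ with h | h
      · have := hb3 j ⟨h, hne⟩; omega
      · have := hc3 j ⟨h, hne⟩; omega
    · rw [show b + 1 + ((c - (b + 1)).toNat : ℤ) = c by omega]
      exact hc2
  obtain ⟨a, t, n, hn, h, hl, hr⟩ := hrun (max n₀ p)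
  obtain ⟨a', t', n', hn', h', hl', hr'⟩ := hrun (n + 1)
  refine run_length_unique hp hy hcount ?_ (le_trans (le_max_left _ _) hn)
    (le_trans (le_max_right _ _) hn) (by omega) h hl hr h' hl' hr'
  rintro w ⟨b, m, rfl⟩
  obtain ⟨c, -, hc⟩ := hyx b m 0
  exact ⟨c, m, hc.symm⟩

/-- If all uniformly recurrent sequences in the orbit closure are periodic, then a periodic
sequence is approximated far to the right. -/
lemma exists_periodic_approx [Finite α]
    (hur : ∀ y : ℤ → α, windows y ⊆ windows x → (Superword.two y).UniformlyRecurrent →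
      (Superword.two y).Periodic) :
    ∃ (y : ℤ → α) (p : ℕ), 0 < p ∧ Function.Periodic y (p : ℤ) ∧
      ∀ (b : ℤ) (n : ℕ) (N : ℤ), ∃ a, N ≤ a ∧ window x a n = window y b n := by
  -- A limit of translates retains only words that occur arbitrarily far to the right.
  obtain ⟨z, hz⟩ := exists_ultralimit fun (n : ℕ) (i : ℤ) => x (n + i)
  have hz' : ∀ (b : ℤ) (n : ℕ) (N : ℤ), ∃ a, N ≤ a ∧ window x a n = window z b n := by
    intro b n N
    obtain ⟨k, hk, h⟩ := exists_agree hz b n (N.natAbs + b.natAbs)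
    refine ⟨k + b, by omega, window_eq_window_iff.2 fun j hj => ?_⟩
    rw [← h j hj, add_assoc]
  obtain ⟨y, hyz, hy⟩ := exists_uniformlyRecurrent (factorClosed_windows z)
    fun n => ⟨window z 0 n, window_mem_windows _ _ _, by simp⟩
  have hy' : ∀ (b : ℤ) (n : ℕ) (N : ℤ), ∃ a, N ≤ a ∧ window x a n = window y b n := by
    intro b n N
    obtain ⟨c, m, hc⟩ := hyz (window_mem_windows y b n)
    obtain rfl : n = m := by simpa using congrArg List.length hc
    rw [hc]
    exact hz' c n N
  obtain ⟨p, hp, hper⟩ := hur y (by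
    rintro w ⟨b, m, rfl⟩
    obtain ⟨c, -, hc⟩ := hy' b m 0
    exact ⟨c, m, hc.symm⟩) hy
  exact ⟨y, p, hp, hper, hy'⟩

end Runs

/-! ### Reversal -/

section Reversal

variable {α : Type*} {x y : ℤ → α}

/-- Reflection carries the positions a, …, a + n - 1 to 1 - a - n, …, -a. -/
lemma window_neg (x : ℤ → α) (a : ℤ) (n : ℕ) :
    window (fun i => x (-i)) a n = (window x (1 - a - n) n).reverse := by
  apply List.ext_getElem (by simp)
  intro j h1 h2
  rw [List.getElem_reverse, getElem_window, getElem_window]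
  simp only [length_window] at h1 ⊢
  congr 1
  omega

lemma windows_neg (x : ℤ → α) : windows (fun i => x (-i)) = List.reverse '' windows x := by
  ext w
  constructor
  · rintro ⟨a, n, rfl⟩
    exact ⟨_, window_mem_windows _ _ _, (window_neg x a n).symm⟩
  · rintro ⟨_, ⟨a, n, rfl⟩, rfl⟩
    refine ⟨1 - a - n, n, ?_⟩
    rw [window_neg]
    congr 2
    ring

lemma wordCount_windows_neg (x : ℤ → α) (n : ℕ) :
    wordCount (windows fun i => x (-i)) n = wordCount (windows x) n := by
  refine Eq.trans ?_ (List.reverse_injective.injOn.ncard_image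
    (s := {w | w ∈ windows x ∧ w.length = n}))
  rw [wordCount, windows_neg]
  congr 1
  ext w
  constructor
  · rintro ⟨⟨v, hv, rfl⟩, h⟩
    exact ⟨v, ⟨hv, by simpa using h⟩, rfl⟩
  · rintro ⟨v, ⟨hv, h⟩, rfl⟩
    exact ⟨⟨v, hv, rfl⟩, by simpa using h⟩

lemma occursAt_two_iff {v : List α} {i : ℤ} :
    (Superword.two x).OccursAt v i ↔ v = window x i v.length := by
  rw [eq_window_iff]
  refine forall₂_congr fun j hj => ?_
  rw [List.getElem?_eq_getElem hj]
  simp [Superword.letter, eq_comm]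

lemma occursAt_neg {v : List α} {i : ℤ} (h : (Superword.two x).OccursAt v.reverse i) :
    (Superword.two fun i => x (-i)).OccursAt v (1 - i - v.length) := by
  rw [occursAt_two_iff] at h ⊢
  rw [window_neg, show 1 - (1 - i - (v.length : ℤ)) - v.length = i by ring]
  simpa [List.reverse_eq_iff] using h

lemma uniformlyRecurrent_neg (h : (Superword.two x).UniformlyRecurrent) :
    (Superword.two fun i => x (-i)).UniformlyRecurrent := by
  obtain ⟨h1, h2⟩ := h
  simp only [Superword.Recurrent, factors_two] at h1 h2
  refine ⟨?_, ?_⟩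
  · intro v hv N
    rw [factors_two, windows_neg] at hv
    obtain ⟨w, hw, rfl⟩ := hv
    obtain ⟨⟨i, hi, hi'⟩, -⟩ := h1 w hw (1 - N - w.length)
    obtain ⟨-, ⟨j, hj, hj'⟩⟩ := h1 w hw (1 - N - w.length)
    rw [← List.reverse_reverse w] at hi' hj'
    exact ⟨⟨_, by simp only [List.length_reverse]; omega, occursAt_neg hj'⟩,
      ⟨_, by simp only [List.length_reverse]; omega, occursAt_neg hi'⟩⟩
  · rw [factors_two, windows_neg]
    rintro _ ⟨v, hv, rfl⟩
    obtain ⟨N, hN⟩ := h2 v hv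
    refine ⟨N, ?_⟩
    rintro _ ⟨u, hu, rfl⟩ hl
    exact List.reverse_infix.2 (hN u hu (by simpa using hl))

/-- A sequence of complexity `n + K` all of whose uniformly recurrent limits are periodic is
periodic far to the right and far to the left. -/
lemma exists_periodic_ends [Finite α] {n₀ : ℕ}
    (hcount : ∀ n, n₀ ≤ n → wordCount (windows x) (n + 1) ≤ wordCount (windows x) n + 1)
    (hur : ∀ y : ℤ → α, windows y ⊆ windows x → (Superword.two y).UniformlyRecurrent →
      (Superword.two y).Periodic) :
    ∃ (p q : ℕ) (i₀ i₁ : ℤ), 0 < p ∧ 0 < q ∧ (∀ i, i₀ ≤ i → x (i + p) = x i) ∧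
      ∀ i, i ≤ i₁ → x (i - q) = x i := by
  obtain ⟨y, p, hp, hy, hyx⟩ := exists_periodic_approx hur
  obtain ⟨i₀, h₀⟩ := eventually_periodic hp hy hcount hyx
  obtain ⟨z, q, hq, hz, hzx⟩ := exists_periodic_approx (x := fun i => x (-i)) (by
    intro z hzx hz
    obtain ⟨p, hp, h⟩ := hur (fun i => z (-i)) (by
      rw [windows_neg]
      rw [windows_neg] at hzx
      rintro _ ⟨w, hw, rfl⟩
      obtain ⟨v, hv, rfl⟩ := hzx hw
      simpa using hv) (uniformlyRecurrent_neg hz)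
    refine ⟨p, hp, fun i => ?_⟩
    have := h (-i - p)
    simp only [sub_add_cancel, neg_neg, neg_sub] at this
    rw [this]
    congr 1
    ring)
  obtain ⟨i₁, h₁⟩ := eventually_periodic hq hz (n₀ := n₀)
    (by simpa only [wordCount_windows_neg] using hcount) hzx
  refine ⟨p, q, i₀, -i₁, hp, hq, h₀, fun i hi => ?_⟩
  have := h₁ (-i) (by omega)
  simpa [sub_eq_add_neg, add_comm] using this

end Reversal

/-! ### The normal basis -/

/-- Equal lengths exclude proper prefixes, the only case in which appending can spoil a
lexicographic comparison. -/
lemma lex_append_of_length_eq {α : Type*} {r : α → α → Prop} {v w : List α} (h : List.Lex r v w)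
    (hl : v.length = w.length) (t : List α) : List.Lex r (v ++ t) (w ++ t) := by
  induction h with
  | nil => simp at hl
  | cons _ ih => exact .cons (ih (by simpa using hl))
  | rel h => exact .rel h

lemma shortlex_append_append {α : Type*} {r : α → α → Prop} {v w : List α}
    (h : List.Shortlex r v w) (s t : List α) : List.Shortlex r (s ++ v ++ t) (s ++ w ++ t) := by
  rw [List.append_assoc, List.append_assoc]
  refine List.Shortlex.append_left ?_ s
  rw [List.shortlex_def] at h ⊢
  rcases h with h | ⟨h1, h2⟩
  · exact .inl (by simpa using h)
  · exact .inr ⟨by simpa using h1, lex_append_of_length_eq h2 h1 t⟩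

section NormalBasis

variable (k : Type*) {A : Type*} [Field k] [Ring A] [Algebra k A] {s : ℕ} (a : Fin s → A)

lemma evalWord_append (v w : List (Fin s)) :
    evalWord a (v ++ w) = evalWord a v * evalWord a w := by
  simp [evalWord]

/-- A reduction of a subword, multiplied on both sides, reduces the whole word, because the order is
compatible with concatenation. -/
lemma factorClosed_normalWords : FactorClosed (normalWords k a) := by
  rintro v w ⟨p, q, rfl⟩ hw hv
  apply hw
  rw [evalWord_append, evalWord_append]
  generalize evalWord a v = x at hv
  induction hv using Submodule.span_induction with
  | mem x hx =>
    obtain ⟨v', hv', rfl⟩ := hx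
    exact Submodule.subset_span ⟨p ++ v' ++ q, shortlex_append_append hv' p q, by
      rw [evalWord_append, evalWord_append]⟩
  | zero => simp
  | add x y _ _ hx hy => rw [mul_add, add_mul]; exact add_mem hx hy
  | smul c x _ hx => rw [mul_smul_comm, smul_mul_assoc]; exact Submodule.smul_mem _ c hx

/-- Reductions terminate, the order being well-founded, and never lengthen a word. -/
lemma evalWord_mem_span (w : List (Fin s)) :
    evalWord a w ∈ Submodule.span k
      (evalWord a '' {v | v ∈ normalWords k a ∧ v.length ≤ w.length}) := by
  induction w using (List.Shortlex.wf (r := ((· < ·) : Fin s → Fin s → Prop))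
    wellFounded_lt).induction with
  | _ w ih =>
    by_cases hw : w ∈ normalWords k a
    · exact Submodule.subset_span ⟨w, ⟨hw, le_rfl⟩, rfl⟩
    · refine Submodule.span_le.2 ?_ (not_not.1 hw)
      rintro _ ⟨v, hv, rfl⟩
      have hl : v.length ≤ w.length := by
        rcases List.shortlex_def.1 hv with h | h
        · exact h.le
        · exact h.1.le
      refine Submodule.span_mono (Set.image_mono ?_) (ih v hv)
      exact fun u hu => ⟨hu.1, hu.2.trans hl⟩

/-- The largest of finitely many irreducible words is not a combination of the others, all of which
are smaller; induction removes it. -/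
lemma linearIndepOn_normalWords : LinearIndepOn k (evalWord a) (normalWords k a) := by
  apply linearIndepOn_of_finite
  intro t ht hfin
  lift t to Finset (List (Fin s)) using hfin
  induction t using Finset.strongInduction with
  | H t ih =>
    rcases t.eq_empty_or_nonempty with rfl | hne
    · simp
    obtain ⟨w, hw, hmax⟩ := t.exists_max_image (fun w => toLex (w.length, w)) hne
    have := ih (t.erase w) (Finset.erase_ssubset hw)
      (fun v hv => ht (Finset.mem_of_mem_erase hv))
    have hins := this.insert (x := w) (fun hmem => ht hw (Submodule.span_mono ?_ hmem))
    · rwa [← Finset.coe_insert, Finset.insert_erase hw] at hins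
    · rintro _ ⟨v, hv, rfl⟩
      simp only [Finset.coe_erase, Set.mem_sdiff, Finset.mem_coe, Set.mem_singleton_iff] at hv
      refine ⟨v, ?_, rfl⟩
      have h1 := hmax v hv.1
      have h2 : toLex (v.length, v) < toLex (w.length, w) :=
        lt_of_le_of_ne h1 fun h => hv.2 (congrArg Prod.snd (toLex.injective h))
      rw [Prod.Lex.toLex_lt_toLex] at h2
      exact List.shortlex_def.2 h2

lemma growthV_eq (n : ℕ) :
    growthV k a n = Set.ncard {w | w ∈ normalWords k a ∧ w.length ≤ n} := by
  have hfin : {w | w ∈ normalWords k a ∧ w.length ≤ n}.Finite :=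
    (List.finite_length_le (Fin s) n).subset fun _ h => h.2
  have hspan : Submodule.span k {x : A | ∃ w : List (Fin s), w.length ≤ n ∧ x = evalWord a w} =
      Submodule.span k (evalWord a '' {w | w ∈ normalWords k a ∧ w.length ≤ n}) := by
    apply le_antisymm
    · rw [Submodule.span_le]
      rintro _ ⟨w, hw, rfl⟩
      refine Submodule.span_mono (Set.image_mono ?_) (evalWord_mem_span k a w)
      exact fun u hu => ⟨hu.1, hu.2.trans hw⟩
    · apply Submodule.span_mono
      rintro _ ⟨w, hw, rfl⟩
      exact ⟨w, hw.2, rfl⟩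
  have hli := (linearIndepOn_normalWords k a).mono
    (t := {w | w ∈ normalWords k a ∧ w.length ≤ n}) fun w hw => hw.1
  have : Fintype {w | w ∈ normalWords k a ∧ w.length ≤ n} := hfin.fintype
  have := finrank_span_eq_card hli
  rw [growthV, hspan, Set.image_eq_range, ← Nat.card_coe_set_eq, Nat.card_eq_fintype_card, ← this]

lemma growthT_eq (n : ℕ) : growthT k a n = wordCount (normalWords k a) n := by
  cases n with
  | zero => simp [growthT, growthV_eq, wordCount]
  | succ n =>
    have hfin : {w | w ∈ normalWords k a ∧ w.length ≤ n}.Finite :=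
      (List.finite_length_le (Fin s) n).subset fun _ h => h.2
    have : {w | w ∈ normalWords k a ∧ w.length ≤ n + 1} =
        {w | w ∈ normalWords k a ∧ w.length ≤ n} ∪
          {w | w ∈ normalWords k a ∧ w.length = n + 1} := by
      ext w
      simp only [Set.mem_ofPred_eq, Set.mem_union]
      rw [Nat.le_succ_iff, and_or_left]
    rw [growthT, growthV_eq, growthV_eq, this, Set.ncard_union_eq ?_ hfin (finite_words _ _)]
    · simp [wordCount]
    · rw [Set.disjoint_left]
      rintro w ⟨_, h1⟩ ⟨_, h2⟩
      omega

lemma exists_wordCount_bounds (h : IsBoundary k a) :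
    ∃ C : ℕ, ∀ n, wordCount (normalWords k a) n ≤ n + C ∧
      n ≤ wordCount (normalWords k a) n + C := by
  obtain ⟨C, hC⟩ := h
  refine ⟨C.toNat, fun n => ?_⟩
  have := hC n
  rw [growthT_eq, abs_le] at this
  omega

end NormalBasis

/-! ### Words outside a sublanguage -/

/-- The words `e R^k f` with `e`, `R`, `f` of length at most `b`. -/
def powerWords (α : Type*) (b : ℕ) : Set (List α) :=
  {w | ∃ (e : List α) (R : NEWord α) (f : List α) (k : ℕ), e.length ≤ b ∧ R.1.length ≤ b ∧
    f.length ≤ b ∧ w = e ++ pow R.1 k ++ f}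

section Complement

variable {α : Type*} {L M : Set (List α)}

lemma powerWords_mono {b b' : ℕ} (h : b ≤ b') : powerWords α b ⊆ powerWords α b' := by
  rintro w ⟨e, R, f, k, h1, h2, h3, hw⟩
  exact ⟨e, R, f, k, h1.trans h, h2.trans h, h3.trans h, hw⟩

lemma mem_powerWords_of_length_le [Nonempty α] {b : ℕ} {w : List α} (hb : 0 < b)
    (h : w.length ≤ b) : w ∈ powerWords α b :=
  ⟨w, ⟨[Classical.arbitrary α], by simp⟩, [], 0, h, by simpa, by simp, by simp [pow]⟩

/-- A word with a periodic stretch up to bounded ends is of the form `e R^k f`. -/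
lemma append_window_append_mem_powerWords {x : ℤ → α} {a : ℤ} {p n b : ℕ} {s t : List α}
    (hp : 0 < p) (hx : ∀ i, a ≤ i → i + p < a + n → x (i + p) = x i)
    (hs : s.length ≤ b) (hpb : p ≤ b) (ht : p + t.length ≤ b) :
    s ++ window x a n ++ t ∈ powerWords α b := by
  refine ⟨s, ⟨window x a p, fun h => ?_⟩, window x (a + (p * (n / p) : ℕ)) (n % p) ++ t, n / p,
    hs, by simpa, ?_, ?_⟩
  · have := congrArg List.length h
    simp at this
    omega
  · have := Nat.mod_lt n hp
    simp only [List.length_append, length_window]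
    omega
  · rw [exists_pow_append hx]
    simp only [List.append_assoc]

/-- If a language has boundedly many words of each length outside a sublanguage, then its words
are of the form `e R^k f` or belong to the sublanguage up to bounded ends. -/
lemma mem_powerWords_or_mem [Finite α] [Nonempty α] (hL : FactorClosed L) (hM : FactorClosed M)
    {D : ℕ} (hD : ∀ n, wordCount (L \ M) n ≤ D) {x : ℤ → α} {N : ℕ} (hw : window x 0 N ∈ L) :
    window x 0 N ∈ powerWords α (2 * D + 1) ∨ 2 * D ≤ N ∧ window x D (N - 2 * D) ∈ M := by
  by_cases hN : 2 * D ≤ N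
  swap
  · exact .inl (mem_powerWords_of_length_le (by omega) (by simp; omega))
  by_cases hmid : window x D (N - 2 * D) ∈ M
  · exact .inr ⟨hN, hmid⟩
  left
  -- The D + 1 windows of length N - D all contain the middle, hence lie outside M, where only D
  -- words of this length are available. Two equal windows give the local period t₂ - t₁.
  obtain ⟨t₁, t₂, hlt, ht₂, heq⟩ : ∃ t₁ t₂ : ℕ, t₁ < t₂ ∧ t₂ ≤ D ∧
      window x t₁ (N - D) = window x t₂ (N - D) := by
    have hmaps : ∀ t ∈ (Finset.range (D + 1) : Finset ℕ), window x t (N - D) ∈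
        (finite_words (L \ M) (N - D)).toFinset := by
      intro t ht
      rw [Finset.mem_range] at ht
      rw [Set.Finite.mem_toFinset]
      refine ⟨⟨hL (window_infix_window x (by omega) (by omega)) hw, fun h => hmid ?_⟩, by simp⟩
      exact hM (window_infix_window x (by omega) (by omega)) h
    obtain ⟨i, hi, j, hj, hne, h⟩ := Finset.exists_ne_map_eq_of_card_lt_of_maps_to (by
      rw [Finset.card_range, ← Set.ncard_eq_toFinset_card _ (finite_words _ _)]
      exact Nat.lt_succ_of_le (hD _)) hmaps
    rw [Finset.mem_range] at hi hj
    rcases lt_or_gt_of_ne hne with h' | h'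
    · exact ⟨i, j, h', by omega, h⟩
    · exact ⟨j, i, h', by omega, h.symm⟩
  obtain ⟨p, rfl⟩ := Nat.exists_eq_add_of_lt hlt
  have hsplit : window x 0 N = window x 0 t₁ ++ window x t₁ (N - D + (p + 1)) ++
      window x (t₁ + (N - D + (p + 1)) : ℕ) (D - (t₁ + p + 1)) := by
    conv_lhs => rw [show N = t₁ + (N - D + (p + 1)) + (D - (t₁ + p + 1)) by omega, window_add,
      window_add]
    simp only [zero_add]
  rw [hsplit]
  apply append_window_append_mem_powerWords (p := p + 1) (by omega) _ (by simp; omega) (by omega)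
    (by simp; omega)
  intro i h1 h2
  have := window_eq_window_iff.1 heq (i - t₁).toNat (by omega)
  rw [Int.toNat_of_nonneg (by omega)] at this
  rw [show i = t₁ + (i - t₁) by ring, this]
  congr 1
  push_cast
  ring

/-- The words of the form `e R^k f` in a language form a common part. -/
lemma exists_commonPart [Finite α] (L : Set (List α)) (b : ℕ) :
    ∃ B : CommonPart α, B.superwords = ∅ ∧ B.finiteWords = {w | w ∈ L ∧ w ∈ powerWords α b} := by
  have h1 : Finite {l : List α // l.length ≤ b} := List.finite_length_le α b
  have h2 : Finite {R : NEWord α // R.1.length ≤ b} :=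
    Finite.of_injective (fun R => (⟨R.1.1, R.2⟩ : {l : List α // l.length ≤ b}))
      fun R R' h => by simpa [Subtype.ext_iff] using h
  obtain ⟨n, ⟨φ⟩⟩ := Finite.exists_equiv_fin
    ({l : List α // l.length ≤ b} × {R : NEWord α // R.1.length ≤ b} ×
      {l : List α // l.length ≤ b})
  -- One series per triple of bounded words, with exactly the exponents that give words of L.
  refine ⟨⟨∅, 0, Fin.elim0, Fin.elim0, 0, Fin.elim0, Fin.elim0, n,
    fun j => (φ.symm j).1.1, fun j => (φ.symm j).2.1.1, fun j => (φ.symm j).2.2.1,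
    fun j => {k | (φ.symm j).1.1 ++ pow (φ.symm j).2.1.1.1 k ++ (φ.symm j).2.2.1 ∈ L}⟩, ?_, ?_⟩
  · ext W
    simp [CommonPart.superwords]
  · ext w
    constructor
    · rintro (h | ⟨j, k, hk, rfl⟩)
      · simp at h
      · exact ⟨hk, _, _, _, k, (φ.symm j).1.2, (φ.symm j).2.1.2, (φ.symm j).2.2.2, rfl⟩
    · rintro ⟨hw, e, R, f, k, he, hR, hf, rfl⟩
      refine .inr ⟨φ (⟨e, he⟩, ⟨R, hR⟩, ⟨f, hf⟩), k, ?_, ?_⟩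
      · simpa using hw
      · simp

/-! ### Obstructions -/

/-- Passing to proper subwords outside `M` must stop, and it stops at an obstruction. -/
lemma exists_obstruction_of_notMem {w : List α} (hw : w ∉ M) :
    ∃ O, O <:+: w ∧ IsObstruction M O := by
  induction h : w.length using Nat.strong_induction_on generalizing w with
  | _ n ih =>
    by_cases hob : IsObstruction M w
    · exact ⟨w, List.infix_refl w, hob⟩
    · simp only [IsObstruction, hw, not_false_eq_true, true_and, not_forall] at hob
      obtain ⟨v, hvw, hne, hv⟩ := hob
      obtain ⟨O, hO, hob⟩ := ih v.length (h ▸ lt_of_le_of_ne hvw.length_le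
        fun h => hne (hvw.eq_of_length h)) hv rfl
      exact ⟨O, hO.trans hvw, hob⟩

variable {x : ℤ → α}

lemma mem_obstructionOccurrences_window {a : ℤ} {m : ℕ} {q : ℕ × List α} :
    q ∈ obstructionOccurrences M (window x a m) ↔
      IsObstruction M q.2 ∧ q.1 + q.2.length ≤ m ∧ q.2 = window x (a + q.1) q.2.length := by
  refine and_congr_right fun _ => ⟨?_, ?_⟩
  · rintro ⟨s, t, h, hs⟩
    rw [← hs]
    exact eq_window_of_append h
  · rintro ⟨h1, h2⟩
    refine ⟨window x a q.1, window x (a + (q.1 + q.2.length : ℕ)) (m - (q.1 + q.2.length)), ?_,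
      by simp⟩
    conv_rhs => rw [h2]
    simp only [length_window]
    rw [← window_add, ← window_add]
    congr 1
    omega

/-- An occurrence of an obstruction does not contain another one. -/
lemma obstruction_antichain {i i' : ℤ} {n n' : ℕ} (h : IsObstruction M (window x i n))
    (h' : IsObstruction M (window x i' n')) (h1 : i ≤ i') (h2 : i' + n' ≤ i + n) :
    i' = i ∧ n' = n := by
  have heq : window x i' n' = window x i n := by
    by_contra hne
    exact h'.1 (h.2 _ (window_infix_window x h1 h2) hne)
  have : n' = n := by simpa using congrArg List.length heq
  omega

lemma hasOneObstruction_window {a i : ℤ} {m n : ℕ} (h1 : a ≤ i) (h2 : i + n ≤ a + m)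
    (h : IsObstruction M (window x i n)) (hend : i = a ∨ i + n = a + m)
    (hun : ∀ (i' : ℤ) (n' : ℕ), a ≤ i' → i' + n' ≤ a + m → IsObstruction M (window x i' n') →
      i' = i ∧ n' = n) : HasOneObstruction M (window x a m) := by
  refine ⟨window x i n, (i - a).toNat, by simp only [length_window]; omega, ?_⟩
  ext ⟨j, O⟩
  rw [mem_obstructionOccurrences_window]
  simp only [Set.mem_singleton_iff, Prod.mk.injEq]
  constructor
  · rintro ⟨hO, hj, hOw⟩
    rw [hOw] at hO
    obtain ⟨e1, e2⟩ := hun _ _ (by omega) (by omega) hO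
    rw [e1, e2] at hOw
    exact ⟨by omega, hOw⟩
  · rintro ⟨rfl, rfl⟩
    simp only [length_window]
    exact ⟨h, by omega, by congr 1; omega⟩

lemma hasTwoObstructions_window {a i : ℤ} {m n₁ n₂ : ℕ} (h1 : a < i) (h2 : i + n₂ = a + m)
    (hn₁ : n₁ ≤ m) (hob₁ : IsObstruction M (window x a n₁)) (hob₂ : IsObstruction M (window x i n₂))
    (hun : ∀ (i' : ℤ) (n' : ℕ), a ≤ i' → i' + n' ≤ a + m → IsObstruction M (window x i' n') →
      (i' = a ∧ n' = n₁) ∨ (i' = i ∧ n' = n₂)) : HasTwoObstructions M (window x a m) := by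
  refine ⟨window x a n₁, window x i n₂, (i - a).toNat, by omega,
    by simp only [length_window]; omega, ?_⟩
  ext ⟨j, O⟩
  rw [mem_obstructionOccurrences_window]
  simp only [Set.mem_insert_iff, Set.mem_singleton_iff, Prod.mk.injEq]
  constructor
  · rintro ⟨hO, hj, hOw⟩
    rw [hOw] at hO
    rcases hun _ _ (by omega) (by omega) hO with ⟨e1, e2⟩ | ⟨e1, e2⟩
    · rw [e1, e2] at hOw
      exact .inl ⟨by omega, hOw⟩
    · rw [e1, e2] at hOw
      exact .inr ⟨by omega, hOw⟩
  · rintro (⟨rfl, rfl⟩ | ⟨rfl, rfl⟩)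
    · simp only [length_window]
      exact ⟨hob₁, by omega, by simp⟩
    · simp only [length_window]
      exact ⟨hob₂, by omega, by congr 1; omega⟩

/-- A word outside `M` that belongs to `M` up to bounded ends has a factor with one or two
obstructions at its ends, the remaining ends being bounded. -/
lemma exists_obstruction_decomposition (hM : FactorClosed M) {D N : ℕ} (hN : 2 * D ≤ N)
    (hw : window x 0 N ∉ M) (hmid : window x D (N - 2 * D) ∈ M) :
    ∃ h₁ t h₂ : List α, h₁.length ≤ D ∧ h₂.length ≤ D ∧
      (HasOneObstruction M t ∨ HasTwoObstructions M t) ∧ window x 0 N = h₁ ++ t ++ h₂ := by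
  have hsplit : ∀ i j : ℤ, 0 ≤ i → i ≤ j → j ≤ N → window x 0 N =
      window x 0 i.toNat ++ window x i (j - i).toNat ++ window x j (N - j).toNat := by
    intro i j h0 h1 h2
    have e1 := window_split x h0 (h1.trans h2)
    have e2 := window_split x h1 h2
    simp only [sub_zero, Int.toNat_natCast] at e1
    rw [e1, e2, List.append_assoc]
  have hends : ∀ (i : ℤ) (n : ℕ), i + n ≤ N → IsObstruction M (window x i n) →
      i < D ∨ (N : ℤ) - D < i + n := by
    intro i n h1 hob
    by_contra! h
    exact hob.1 (hM (window_infix_window x h.1 (by omega)) hmid)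
  -- Cut at the last obstruction starting in the left end, and at the next one if it exists; the
  -- latter has to reach the right end. If none starts in the left end, the first obstruction
  -- reaches the right end and closes the factor.
  by_cases hA : ∃ i : ℤ, i < D ∧ ∃ n : ℕ, 0 ≤ i ∧ i + n ≤ N ∧ IsObstruction M (window x i n)
  · obtain ⟨i, ⟨hiD, n, hi0, hiN, hob⟩, hmax⟩ := Int.exists_greatest_of_bdd
      ⟨(D : ℤ), fun z hz => hz.1.le⟩ hA
    by_cases hB : ∃ j : ℤ, i < j ∧ ∃ m : ℕ, j + m ≤ N ∧ IsObstruction M (window x j m)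
    · obtain ⟨j, ⟨hij, m, hjN, hob'⟩, hmin⟩ := Int.exists_least_of_bdd
        ⟨i, fun z hz => hz.1.le⟩ hB
      have hjD : (D : ℤ) ≤ j := by
        by_contra! h
        have := hmax j ⟨h, m, by omega, hjN, hob'⟩
        omega
      have hjend := hends j m hjN hob'
      have hni : i + n ≤ j + m := by
        by_contra! h
        have := obstruction_antichain hob hob' hij.le h.le
        omega
      refine ⟨_, _, _, ?_, ?_, .inr ?_, hsplit i (j + m) hi0 (by omega) hjN⟩
      · simp; omega
      · simp; omega
      · refine hasTwoObstructions_window hij (by omega) (by omega) hob hob' ?_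
        intro i' n' h1 h2 hob''
        rcases h1.lt_or_eq with h1 | rfl
        · have := hmin i' ⟨h1, n', by omega, hob''⟩
          exact .inr (obstruction_antichain hob' hob'' this (by omega))
        · left
          rcases le_total n n' with h | h
          · have := obstruction_antichain hob'' hob le_rfl (by omega)
            omega
          · exact obstruction_antichain hob hob'' le_rfl (by omega)
    · refine ⟨_, _, _, ?_, ?_, .inl ?_, hsplit i N hi0 (by omega) le_rfl⟩
      · simp; omega
      · simp
      · refine hasOneObstruction_window le_rfl (by omega) hob (.inl rfl) ?_
        intro i' n' h1 h2 hob'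
        rcases h1.lt_or_eq with h1 | rfl
        · exact absurd ⟨i', h1, n', by omega, hob'⟩ hB
        · rcases le_total n n' with h | h
          · have := obstruction_antichain hob' hob le_rfl (by omega)
            omega
          · exact obstruction_antichain hob hob' le_rfl (by omega)
  · have hB : ∃ i : ℤ, 0 ≤ i ∧ ∃ n : ℕ, i + n ≤ N ∧ IsObstruction M (window x i n) := by
      obtain ⟨O, hO, hob⟩ := exists_obstruction_of_notMem hw
      obtain ⟨i, hi, hOw⟩ := exists_eq_window_of_infix hO
      rw [hOw] at hob
      exact ⟨0 + i, by omega, O.length, by omega, hob⟩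
    obtain ⟨i, ⟨hi0, n, hiN, hob⟩, hmin⟩ := Int.exists_least_of_bdd ⟨0, fun z hz => hz.1⟩ hB
    have hend : (N : ℤ) - D < i + n := by
      rcases hends i n hiN hob with h | h
      · exact absurd ⟨i, h, n, hi0, hiN, hob⟩ hA
      · exact h
    refine ⟨_, _, _, ?_, ?_, .inl ?_, hsplit 0 (i + n) le_rfl (by omega) hiN⟩
    · simp
    · simp; omega
    · refine hasOneObstruction_window hi0 (by omega) hob (.inr (by omega)) ?_
      intro i' n' h1 h2 hob'
      exact obstruction_antichain hob hob' (hmin i' ⟨h1, n', by omega, hob'⟩) (by omega)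

/-- The words of a language with one or two obstructions up to bounded ends form finitely many
series. -/
lemma exists_obstructionSeries [Finite α] (W : Superword α) (L : Set (List α)) (b : ℕ) :
    ∃ Z : ObstructionSeries W, (∀ i, (Z.h₁ i).length + (Z.h₂ i).length < 2 * b + 1) ∧
      Z.words = {w | w ∈ L ∧ ∃ h₁ t h₂ : List α, h₁.length ≤ b ∧ h₂.length ≤ b ∧
        (HasOneObstruction W.factors t ∨ HasTwoObstructions W.factors t) ∧
          w = h₁ ++ t ++ h₂} := by
  have h1 : Finite {l : List α // l.length ≤ b} := List.finite_length_le α b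
  obtain ⟨n, ⟨φ⟩⟩ := Finite.exists_equiv_fin
    ({l : List α // l.length ≤ b} × {l : List α // l.length ≤ b})
  refine ⟨⟨n, fun j => (φ.symm j).1.1, fun j => (φ.symm j).2.1,
    fun j => {t | (φ.symm j).1.1 ++ t ++ (φ.symm j).2.1 ∈ L ∧
      (HasOneObstruction W.factors t ∨ HasTwoObstructions W.factors t)},
    fun j t ht => ht.2⟩, fun j => ?_, ?_⟩
  · have := (φ.symm j).1.2
    have := (φ.symm j).2.2
    simp only
    omega
  · ext w
    constructor
    · rintro ⟨j, t, ⟨hL, ht⟩, rfl⟩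
      exact ⟨hL, _, t, _, (φ.symm j).1.2, (φ.symm j).2.2, ht, rfl⟩
    · rintro ⟨hL, e, t, f, he, hf, ht, rfl⟩
      exact ⟨φ (⟨e, he⟩, ⟨f, hf⟩), t, ⟨by simpa using hL, ht⟩, by simp⟩

end Complement

/-! ### Existence of nonperiodic sequences -/

section Nonperiodic

variable {α : Type*} [Finite α] {L : Set (List α)}

/-- A language with at least `n - C` words of each length `n` has, for every `n`, two words that
agree on their first `n` letters, but not on the following one, which is followed by `n` letters. -/
lemma exists_branching (hL : FactorClosed L) {C : ℕ} (hC : ∀ n, n ≤ wordCount L n + C) (n : ℕ) :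
    ∃ y y' : ℤ → α, window y (-n) (2 * n + 1) ∈ L ∧ window y' (-n) (2 * n + 1) ∈ L ∧
      (∀ i : ℤ, -n ≤ i → i < 0 → y i = y' i) ∧ y 0 ≠ y' 0 := by
  by_contra! hcon
  -- Without branching, a word of length N is fixed by its first and last n letters, so there are at
  -- most q² such words; N is chosen with N - C > q².
  set q := Set.ncard {l : List α | l.length = n} with hq
  set N := 2 * n + (q * q + C + 1) with hN
  have : Nonempty α := by
    have h1 : 0 < wordCount L (C + 1) := by have := hC (C + 1); omega
    obtain ⟨w, -, hw⟩ := (Set.ncard_pos (finite_words _ _)).1 h1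
    exact ⟨w[0]⟩
  have hle : wordCount L N ≤ q * q := by
    rw [hq, ← Set.ncard_prod]
    refine Set.ncard_le_ncard_of_injOn (fun w => (w.take n, w.drop (N - n))) ?_ ?_
      ((List.finite_length_eq α n).prod (List.finite_length_eq α n))
    · rintro w ⟨-, hw⟩
      simp only [Set.mem_prod, Set.mem_ofPred_eq, List.length_take, List.length_drop, hw]
      omega
    · rintro w ⟨hwL, hw⟩ w' ⟨hwL', hw'⟩ h
      obtain ⟨x, hx⟩ := exists_eq_window w
      obtain ⟨x', hx'⟩ := exists_eq_window w'
      rw [hw] at hx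
      rw [hw'] at hx'
      simp only [Prod.mk.injEq] at h
      have hstart : ∀ j : ℕ, j < n → x j = x' j := by
        have h1 := h.1
        rw [hx, hx', show N = n + (N - n) by omega, window_add, window_add,
          List.take_left' (by simp), List.take_left' (by simp), window_eq_window_iff] at h1
        simpa using h1
      have hend : ∀ j : ℕ, N - n ≤ j → j < N → x j = x' j := by
        intro j h1 h2
        have h3 := h.2
        have e : N = (N - n) + n := by omega
        rw [hx, hx'] at h3
        have s1 : window x 0 N = window x 0 (N - n) ++ window x (0 + (N - n : ℕ)) n := by
          rw [← window_add, ← e]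
        have s2 : window x' 0 N = window x' 0 (N - n) ++ window x' (0 + (N - n : ℕ)) n := by
          rw [← window_add, ← e]
        rw [s1, s2, List.drop_left' (by simp), List.drop_left' (by simp),
          window_eq_window_iff] at h3
        have := h3 (j - (N - n)) (by omega)
        rwa [show (0 : ℤ) + (N - n : ℕ) + (j - (N - n) : ℕ) = j by omega] at this
      rw [hx, hx', window_eq_window_iff]
      intro j hj
      simp only [zero_add]
      induction j using Nat.strong_induction_on with
      | _ j ih =>
        rcases lt_or_ge j n with h1 | h1
        · exact hstart j h1
        rcases lt_or_ge j (N - n) with h2 | h2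
        swap
        · exact hend j h2 hj
        have hshift : ∀ z : ℤ → α, window z 0 N ∈ L →
            window (fun i => z (i + j)) (-n) (2 * n + 1) ∈ L := by
          intro z hz
          have : window (fun i => z (i + j)) (-n) (2 * n + 1) = window z (j - n) (2 * n + 1) := by
            rw [window_eq_window_iff]
            intro i _
            congr 1
            ring
          rw [this]
          exact hL (window_infix_window z (by omega) (by push_cast; omega)) hz
        have := hcon _ _ (hshift x (hx ▸ hwL)) (hshift x' (hx' ▸ hwL')) (by
          intro i hi1 hi2
          have := ih (i + j).toNat (by omega) (by omega)
          rwa [Int.toNat_of_nonneg (by omega)] at this)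
        simpa using this
  have := hC N
  omega

/-- A language with at least `n - C` words of each length `n` contains the subwords of a
nonperiodic two-sided sequence. -/
lemma exists_nonperiodic (hL : FactorClosed L) {C : ℕ} (hC : ∀ n, n ≤ wordCount L n + C) :
    ∃ x : ℤ → α, windows x ⊆ L ∧ ¬ (Superword.two x).Periodic := by
  choose y y' h1 h2 h3 h4 using exists_branching hL hC
  obtain ⟨x, hx⟩ := exists_ultralimit fun (n : ℕ) (i : ℤ) => (y n i, y' n i)
  have hwin : ∀ (a : ℤ) (m N : ℕ), ∃ n, N ≤ n ∧ window (y n) a m = window (fun i => (x i).1) a m ∧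
      window (y' n) a m = window (fun i => (x i).2) a m := by
    intro a m N
    obtain ⟨n, hn, h⟩ := exists_agree hx a m N
    exact ⟨n, hn, window_eq_window_iff.2 fun j hj => congrArg Prod.fst (h j hj),
      window_eq_window_iff.2 fun j hj => congrArg Prod.snd (h j hj)⟩
  have hsub1 : windows (fun i => (x i).1) ⊆ L := by
    rintro w ⟨a, m, rfl⟩
    obtain ⟨n, hn, h, -⟩ := hwin a m (a.natAbs + m)
    rw [← h]
    exact hL (window_infix_window _ (by omega) (by push_cast; omega)) (h1 n)
  have hsub2 : windows (fun i => (x i).2) ⊆ L := by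
    rintro w ⟨a, m, rfl⟩
    obtain ⟨n, hn, -, h⟩ := hwin a m (a.natAbs + m)
    rw [← h]
    exact hL (window_infix_window _ (by omega) (by push_cast; omega)) (h2 n)
  have hneg : ∀ i : ℤ, i < 0 → (x i).1 = (x i).2 := by
    intro i hi
    obtain ⟨n, hn, h⟩ := exists_agree hx i 1 i.natAbs
    have := h 0 one_pos
    simp only [Nat.cast_zero, add_zero] at this
    rw [← this]
    exact h3 n i (by omega) hi
  have hzero : (x 0).1 ≠ (x 0).2 := by
    obtain ⟨n, hn, h⟩ := exists_agree hx 0 1 0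
    have := h 0 one_pos
    simp only [Nat.cast_zero, add_zero] at this
    rw [← this]
    exact h4 n
  by_contra! hcon
  obtain ⟨p, hp, hper⟩ := hcon _ hsub1
  obtain ⟨q, hq, hqer⟩ := hcon _ hsub2
  -- The common period pq moves 0 to a negative position, where both sequences agree.
  have e1 : Function.Periodic (fun i => (x i).1) ((q : ℤ) * p) :=
    (show Function.Periodic (fun i => (x i).1) (p : ℤ) from hper).int_mul q
  have e2 : Function.Periodic (fun i => (x i).2) ((p : ℤ) * q) :=
    (show Function.Periodic (fun i => (x i).2) (q : ℤ) from hqer).int_mul p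
  have e3 := e1 (-(p * q))
  have e4 := e2 (-(p * q))
  simp only [mul_comm (q : ℤ) p, neg_add_cancel] at e3 e4
  apply hzero
  rw [e3, e4]
  exact hneg _ (by have : (0 : ℤ) < p * q := by positivity
                   omega)

end Nonperiodic

/-! ### Uniformly recurrent superwords -/

/-- A uniformly recurrent nonperiodic superword has the same finite subwords as some nonperiodic
two-sided sequence. -/
lemma exists_windows_eq_factors {α : Type*} [Finite α] {W : Superword α}
    (hW : W.UniformlyRecurrent) (hper : ¬ W.Periodic) :
    ∃ x : ℤ → α, windows x = W.factors ∧ ¬ (Superword.two x).Periodic := by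
  -- Any such `x` works: by uniform recurrence its long windows contain every subword of `W`.
  obtain ⟨x, hx⟩ := exists_windows_subset (factorClosed_factors W) (exists_mem_factors_length W)
  have heq : windows x = W.factors := by
    refine hx.antisymm fun v hv => ?_
    obtain ⟨N, hN⟩ := hW.2 v hv
    exact factorClosed_windows x (hN _ (hx (window_mem_windows x 0 N)) (by simp))
      (window_mem_windows x 0 N)
  refine ⟨x, heq, ?_⟩
  rintro ⟨p, hp, hxp⟩
  -- Periodicity is visible in the subwords of length p + 1, so it would pass from `x` to `W`.
  have key : ∀ v ∈ W.factors, ∀ h : v.length = p + 1, v[p] = v[0] := by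
    intro v hv h
    rw [← heq] at hv
    obtain ⟨a, n, rfl⟩ := hv
    rw [getElem_window, getElem_window, hxp]
    simp
  apply hper
  cases W with
  | right f =>
    refine ⟨p, hp, fun n => ?_⟩
    have := key (List.ofFn fun j : Fin (p + 1) => f (n + j)) ⟨n, fun j hj => ?_⟩ (by simp)
    · rw [List.getElem_ofFn, List.getElem_ofFn] at this
      simpa using this
    · rw [List.getElem?_eq_getElem hj, List.getElem_ofFn]
      rfl
  | left f =>
    refine ⟨p, hp, fun n => ?_⟩
    have := key (List.ofFn fun j : Fin (p + 1) => f (n + p - j)) ⟨-(n + p) - 1, fun j hj => ?_⟩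
      (by simp)
    · rw [List.getElem_ofFn, List.getElem_ofFn] at this
      simpa using this.symm
    · rw [List.getElem?_eq_getElem hj, List.getElem_ofFn]
      simp only [List.length_ofFn] at hj
      rw [show (-(n + p) - 1 + j : ℤ) = Int.negSucc (n + p - j) by omega]
      rfl
  | two f =>
    refine ⟨p, hp, fun i => ?_⟩
    have := key (window f i (p + 1)) (by rw [factors_two]; exact window_mem_windows _ _ _) (by simp)
    simpa [getElem_window] using this

/-! ### The two cases -/

section Cases

variable {α : Type*} [Finite α] {L : Set (List α)}

/-- Meant for the language `M` of a nonperiodic sequence, where Morse and Hedlund supply the lower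
bound. -/
lemma wordCount_diff_le {M : Set (List α)} (hML : M ⊆ L) {C : ℕ} {n : ℕ}
    (h : wordCount L n ≤ n + C) (hM : n ≤ wordCount M n) : wordCount (L \ M) n ≤ C := by
  have h1 : {w | w ∈ L \ M ∧ w.length = n} =
      {w | w ∈ L ∧ w.length = n} \ {w | w ∈ M ∧ w.length = n} := by
    ext w
    simp only [Set.mem_sdiff, Set.mem_ofPred_eq]
    tauto
  have h2 := Set.ncard_sdiff_add_ncard_of_subset (s := {w | w ∈ M ∧ w.length = n})
    (t := {w | w ∈ L ∧ w.length = n}) (fun w hw => ⟨hML hw.1, hw.2⟩) (finite_words _ _)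
  unfold wordCount at *
  rw [h1]
  omega

lemma encard_le_of_wordCount_le {F G : Set (List α)} {n D : ℕ} (hF : wordCount F n ≤ D)
    (h : ∀ w ∈ G, w ∈ F ∧ w.length = n) : G.encard ≤ (D : ℕ∞) := by
  refine (Set.encard_le_encard (show G ⊆ {w | w ∈ F ∧ w.length = n} from h)).trans ?_
  rw [← (finite_words F n).cast_ncard_eq]
  exact_mod_cast hF

/-- The second case. -/
lemma caseTwo_of_wordCount [Nonempty α] (hL : FactorClosed L) {C : ℕ} (hC : ∀ n, wordCount L n ≤ n + C)
    {W : Superword α} (hWL : W.factors ⊆ L) (hW : W.UniformlyRecurrent) (hper : ¬ W.Periodic) :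
    CaseTwo L W := by
  obtain ⟨x, hx, hxper⟩ := exists_windows_eq_factors hW hper
  have hcard : ∀ n, wordCount W.factors n ≤ n + C := fun n => by
    refine le_trans (Set.ncard_le_ncard ?_ (finite_words _ _)) (hC n)
    exact fun w hw => ⟨hWL hw.1, hw.2⟩
  have hD : ∀ n, wordCount (L \ W.factors) n ≤ C := fun n =>
    wordCount_diff_le hWL (hC n) (by rw [← hx]; exact (lt_wordCount hxper n).le)
  obtain ⟨K, N, hK⟩ := exists_wordCount_eq hxper (by simpa only [hx] using hcard)
  rw [hx] at hK
  refine ⟨⟨K, N, hK⟩, ?_⟩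
  obtain ⟨B, hBs, hBw⟩ := exists_commonPart L (2 * C + 1)
  obtain ⟨Z, hZb, hZw⟩ := exists_obstructionSeries W L C
  refine ⟨B, ⟨0, Fin.elim0, Fin.elim0, Fin.elim0, fun i => i.elim0, fun i => i.elim0,
    fun i => i.elim0⟩, ⟨0, Fin.elim0, Fin.elim0, Fin.elim0, fun i => i.elim0, fun i => i.elim0,
    fun i => i.elim0⟩, Z, ⟨2 * C + 1, by omega, hZb⟩, ⟨C + 1, by omega, fun n => ?_⟩, ?_⟩
  · refine encard_le_of_wordCount_le ((hD n).trans (by omega)) ?_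
    rintro w ⟨h | ⟨_, h, _⟩, hn, hw⟩
    · obtain ⟨t, ht, hwt⟩ := h
      rw [hZw] at ht
      exact ⟨⟨hL hwt ht.1, hw⟩, hn⟩
    · exact h.elim
  · rw [hBs, hBw, hZw]
    ext w
    constructor
    · intro hw
      by_cases hwW : w ∈ W.factors
      · exact .inr ⟨W, by simp, hwW⟩
      refine .inl ⟨w, ?_, List.infix_refl w⟩
      obtain ⟨y, hy⟩ := exists_eq_window w
      rw [hy] at hw hwW ⊢
      rcases mem_powerWords_or_mem hL (factorClosed_factors W) hD hw with h | ⟨hN, h⟩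
      · exact .inl ⟨hw, h⟩
      · exact .inr ⟨hw, exists_obstruction_decomposition (factorClosed_factors W) hN hwW h⟩
    · rintro (⟨t, ht | ht, hwt⟩ | ⟨V, hV, hwV⟩)
      · exact hL hwt ht.1
      · exact hL hwt ht.1
      · rcases hV with ((h | ⟨i, _⟩) | ⟨i, _⟩) | rfl
        · exact h.elim
        · exact i.elim0
        · exact i.elim0
        · exact hWL hwV

end Cases

/-! ### Case 1: sequences with periodic ends -/

section CaseOne

variable {α : Type*} {L : Set (List α)}

lemma biSeq_of_nonneg (u v : NEWord α) (c : List α) {i : ℤ} (hi : 0 ≤ i) :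
    biSeq u c v i = prepend c (perSeq v) i.toNat := by
  obtain ⟨n, rfl⟩ := Int.eq_ofNat_of_zero_le hi
  rfl

lemma biSeq_of_neg (u v : NEWord α) (c : List α) {i : ℤ} (hi : i < 0) :
    biSeq u c v i = perSeq u.reverse (-i - 1).toNat := by
  obtain ⟨n, rfl⟩ := Int.eq_negSucc_of_lt_zero hi
  rw [show (-Int.negSucc n - 1).toNat = n by omega]
  rfl

lemma perSeq_add_length (u : NEWord α) (n : ℕ) : perSeq u (n + u.1.length) = perSeq u n := by
  simp [perSeq]

/-- The condition says that `m` and `n` are mirror positions modulo the length of `u`; it joins the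
two halves of `perBiSeq` at 0. -/
lemma perSeq_reverse (u : NEWord α) {m n : ℕ} (h : (m + n + 1) % u.1.length = 0) :
    perSeq u.reverse n = perSeq u m := by
  have hl : 0 < u.1.length := List.length_pos_iff.2 u.2
  simp only [perSeq, NEWord.reverse, List.length_reverse, List.getElem_reverse]
  congr 1
  have h1 := Nat.mod_lt n hl
  have h2 := Nat.mod_lt m hl
  have h3 : (m % u.1.length + n % u.1.length + 1) % u.1.length = 0 := by
    rw [← h, Nat.add_mod, Nat.add_mod (m % _), Nat.mod_mod, Nat.mod_mod, ← Nat.add_mod m n,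
      ← Nat.add_mod]
  obtain ⟨k, hk⟩ := Nat.dvd_of_mod_eq_zero h3
  have : k = 1 := by
    rcases k with _ | _ | k
    · omega
    · rfl
    · exfalso
      rw [mul_add, mul_add] at hk
      nlinarith [Nat.zero_le (u.1.length * k)]
  subst this
  omega

lemma perBiSeq_periodic (u : NEWord α) : Function.Periodic (perBiSeq u) (u.1.length : ℤ) := by
  intro i
  have hl : 0 < u.1.length := List.length_pos_iff.2 u.2
  have hprep : prepend [] (perSeq u) = perSeq u := by
    funext n
    simp [prepend]
  rw [perBiSeq]
  rcases lt_or_ge i 0 with hi | hi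
  · rw [biSeq_of_neg _ _ _ hi]
    rcases lt_or_ge (i + u.1.length) 0 with hi' | hi'
    · have hr : u.reverse.1.length = u.1.length := by simp [NEWord.reverse]
      rw [biSeq_of_neg _ _ _ hi', ← perSeq_add_length, hr]
      congr 1
      omega
    · rw [biSeq_of_nonneg _ _ _ hi', hprep]
      refine (perSeq_reverse u ?_).symm
      rw [show (i + u.1.length).toNat + (-i - 1).toNat + 1 = u.1.length by omega, Nat.mod_self]
  · rw [biSeq_of_nonneg _ _ _ hi, biSeq_of_nonneg _ _ _ (by omega), hprep,
      ← perSeq_add_length u i.toNat]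
    congr 1
    omega

lemma periodic_right_iterate {z : ℤ → α} {l : ℤ} {p : ℕ} (h : ∀ i, l ≤ i → z (i + p) = z i)
    (t : ℕ) {i : ℤ} (hi : l ≤ i) : z (i + (p * t : ℕ)) = z i := by
  induction t with
  | zero => simp
  | succ t ih =>
    rw [Nat.mul_succ, Nat.cast_add, ← add_assoc, h _ (by omega), ih]

lemma periodic_left_iterate {z : ℤ → α} {l : ℤ} {q : ℕ} (h : ∀ i, i ≤ l → z (i - q) = z i)
    (t : ℕ) {i : ℤ} (hi : i ≤ l) : z (i - (q * t : ℕ)) = z i := by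
  induction t with
  | zero => simp
  | succ t ih =>
    rw [Nat.mul_succ, Nat.cast_add, ← sub_sub, h _ (by omega), ih]

lemma perSeq_window {z : ℤ → α} {a : ℤ} {p : ℕ} (h : window z a p ≠ []) (n : ℕ) :
    perSeq ⟨window z a p, h⟩ n = z (a + (n % p : ℕ)) := by
  simp only [perSeq, length_window, getElem_window]

lemma perSeq_reverse_window {z : ℤ → α} {a : ℤ} {p : ℕ} (hp : 0 < p) (h : window z a p ≠ [])
    (n : ℕ) : perSeq (NEWord.reverse ⟨window z a p, h⟩) n = z (a + p - 1 - (n % p : ℕ)) := by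
  have := Nat.mod_lt n hp
  simp only [perSeq, NEWord.reverse, List.length_reverse, length_window, List.getElem_reverse,
    getElem_window]
  congr 1
  omega

/-- A sequence with periodic ends is of the form `u^{∞/2} c v^{∞/2}`. -/
lemma biSeq_window {z : ℤ → α} {l p q : ℕ} (hq : 0 < q)
    (hr : ∀ i : ℤ, l ≤ i → z (i + p) = z i) (hl : ∀ i : ℤ, i ≤ 0 → z (i - q) = z i)
    (hu : window z (-q) q ≠ []) (hv : window z l p ≠ []) :
    biSeq ⟨window z (-q) q, hu⟩ (window z 0 l) ⟨window z l p, hv⟩ = z := by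
  funext i
  rcases lt_or_ge i 0 with hi | hi
  · rw [biSeq_of_neg _ _ _ hi, perSeq_reverse_window hq]
    obtain ⟨n, rfl⟩ := Int.eq_negSucc_of_lt_zero hi
    rw [show (-Int.negSucc n - 1).toNat = n by omega]
    have h1 := Nat.div_add_mod n q
    have h2 := Nat.mod_lt n hq
    have h3 := periodic_left_iterate (l := -1) (fun i hi => hl i (by omega)) (n / q)
      (i := -1 - (n % q : ℕ)) (by omega)
    rw [show (-q + q - 1 - (n % q : ℕ) : ℤ) = -1 - (n % q : ℕ) by ring, ← h3]
    congr 1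
    omega
  · obtain ⟨n, rfl⟩ := Int.eq_ofNat_of_zero_le hi
    rw [biSeq_of_nonneg _ _ _ hi, prepend]
    simp only [Int.toNat_natCast, length_window]
    split_ifs with h
    · rw [getElem_window, zero_add]
    · rw [perSeq_window]
      have h1 := Nat.div_add_mod (n - l) p
      rw [← periodic_right_iterate hr ((n - l) / p) (by omega)]
      congr 1
      omega

/-- Up to bounded ends, a subword of a sequence with periodic ends has the form `e R^k f` or
`E u^n c v^m F`. -/
lemma append_window_append_mem [Nonempty α] {z : ℤ → α} {l p q D : ℕ} (hp : 0 < p) (hq : 0 < q)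
    (hr : ∀ i : ℤ, l ≤ i → z (i + p) = z i) (hl : ∀ i : ℤ, i ≤ 0 → z (i - q) = z i)
    {s t : List α} (hs : s.length ≤ D) (ht : t.length ≤ D) (a : ℤ) (n : ℕ) :
    s ++ window z a n ++ t ∈ powerWords α (2 * D + l + p + q) ∨
      ∃ (E F : List α) (k m : ℕ), E.length ≤ D + q ∧ F.length ≤ D + p ∧
        s ++ window z a n ++ t =
          E ++ pow (window z (-q) q) k ++ window z 0 l ++ pow (window z l p) m ++ F := by
  -- Only a window reaching past both ends of [0, l) involves both periods; otherwise at most l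
  -- central letters are absorbed into a bounded end.
  rcases lt_or_ge (l : ℤ) (a + n) with h1 | h1
  · rcases lt_or_ge a 0 with h2 | h2
    · right
      have e1 : window z a n = window z a (-a).toNat ++ window z 0 l ++
          window z l (a + n - l).toNat := by
        have s1 := window_split z (a := a) (b := 0) (c := a + n) (by omega) (by omega)
        have s2 := window_split z (a := 0) (b := l) (c := a + n) (by omega) (by omega)
        rw [show (a + n - a).toNat = n by omega, s2, zero_sub, sub_zero, Int.toNat_natCast] at s1
        rw [s1, List.append_assoc]
      have e2 := exists_pow_append (x := z) (a := l) (p := p) (n := (a + n - l).toNat)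
        fun i hi _ => hr i hi
      set N := (-a).toNat with hN
      have hdm := Nat.div_add_mod N q
      have hml := Nat.mod_lt N hq
      -- The remainder is cut off on the left, so that the blocks end at position 0.
      have e3 : window z a N = window z a (N % q) ++ pow (window z (-q) q) (N / q) := by
        have s1 : window z a N = window z a (N % q) ++ window z (a + (N % q : ℕ)) (q * (N / q)) := by
          rw [← window_add]
          congr 1
          omega
        rw [s1, window_mul_eq_pow]
        · congr 1
          rcases Nat.eq_zero_or_pos (N / q) with h | h
          · simp [h, pow]
          · congr 1
            rw [window_eq_window_iff]
            intro j hj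
            obtain ⟨r, hr⟩ := Nat.exists_eq_add_of_lt h
            have := periodic_left_iterate hl r (i := -q + j) (by omega)
            rw [← this]
            congr 1
            rw [hr] at hdm
            have : q * (0 + r + 1) = q * r + q := by ring
            omega
        · intro i h1 h2
          have h4 : i + q ≤ 0 := by
            have : ((q * (N / q) : ℕ) : ℤ) = q * (N / q : ℕ) := by push_cast; rfl
            omega
          have := hl (i + q) h4
          rwa [add_sub_cancel_right, eq_comm] at this
      refine ⟨s ++ window z a (N % q), window z (l + (p * ((a + n - l).toNat / p) : ℕ))
        ((a + n - l).toNat % p) ++ t, N / q, (a + n - l).toNat / p, ?_, ?_, ?_⟩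
      · simp only [List.length_append, length_window]; omega
      · have := Nat.mod_lt (a + n - l).toNat hp
        simp only [List.length_append, length_window]; omega
      · rw [e1, e2, e3]
        simp only [List.append_assoc]
    · left
      have e1 : window z a n = window z a (l - a).toNat ++
          window z (a + (l - a).toNat) (n - (l - a).toNat) := by
        rw [← window_add]
        congr 1
        omega
      rw [e1, ← List.append_assoc]
      exact append_window_append_mem_powerWords hp (fun i h _ => hr i (by omega))
        (by simp only [List.length_append, length_window]; omega) (by omega) (by omega)
  · left
    rcases lt_or_ge a 0 with h2 | h2
    · have e1 : window z a n = window z a (min n (-a).toNat) ++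
          window z (a + (min n (-a).toNat : ℕ)) (n - min n (-a).toNat) := by
        rw [← window_add]
        congr 1
        omega
      rw [e1, ← List.append_assoc, List.append_assoc _ _ t]
      refine append_window_append_mem_powerWords hq (fun i h3 h4 => ?_) (by omega) (by omega)
        (by simp only [List.length_append, length_window]; omega)
      have := hl (i + q) (by omega)
      rwa [add_sub_cancel_right, eq_comm] at this
    · exact mem_powerWords_of_length_le (by omega)
        (by simp only [List.length_append, length_window]; omega)

/-- The first case, given a nonperiodic sequence with periodic ends. -/
lemma caseOne_of_periodic_ends [Finite α] [Nonempty α] (hL : FactorClosed L) {C : ℕ}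
    (hC : ∀ n, wordCount L n ≤ n + C) {z : ℤ → α} (hzL : windows z ⊆ L)
    (hz : ¬ (Superword.two z).Periodic) {l p q : ℕ} (hp : 0 < p) (hq : 0 < q)
    (hr : ∀ i : ℤ, l ≤ i → z (i + p) = z i) (hl : ∀ i : ℤ, i ≤ 0 → z (i - q) = z i) :
    CaseOne L := by
  have hne : ∀ (a : ℤ) {n : ℕ}, 0 < n → window z a n ≠ [] := by
    intro a n hn h
    have := congrArg List.length h
    simp at this
    omega
  have hD : ∀ n, wordCount (L \ windows z) n ≤ C := fun n =>
    wordCount_diff_le hzL (hC n) (lt_wordCount hz n).le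
  have hbi := biSeq_window hq hr hl (hne _ hq) (hne _ hp)
  obtain ⟨B, hBs, hBw⟩ := exists_commonPart L (2 * C + l + p + q)
  -- Subwords of `z` are left out of the last set, since only then are there at most C words of each
  -- length; the two-sided word supplies them.
  refine ⟨⟨window z (-q) q, hne _ hq⟩, ⟨window z l p, hne _ hp⟩, window z 0 l, B,
    {w | (w ∈ L ∧ w ∉ windows z) ∧ ∃ (E F : List α) (k m : ℕ), E.length ≤ C + q + p ∧
      F.length ≤ C + q + p ∧ w = E ++ pow (window z (-q) q) k ++ window z 0 l ++
        pow (window z l p) m ++ F}, ?_, ⟨C + q + p, fun w hw => hw.2⟩,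
    ⟨C + 1, by omega, fun k => ?_⟩, ?_⟩
  · rintro ⟨t, ht⟩
    rw [hbi] at ht
    refine hz ⟨q, hq, fun i => ?_⟩
    have := perBiSeq_periodic ⟨window z (-q) q, hne _ hq⟩ (i + t)
    simp only [length_window] at this
    rw [ht, ht, ← this]
    congr 1
    ring
  · refine lt_of_le_of_lt (encard_le_of_wordCount_le (hD k) ?_)
      (by exact_mod_cast Nat.lt_succ_self C)
    rintro w ⟨⟨hw, -⟩, hk⟩
    exact ⟨hw, hk⟩
  · rw [hBs, hBw, hbi]
    ext w
    constructor
    · intro hw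
      by_cases hwz : w ∈ windows z
      · exact .inr ⟨Superword.two z, by simp, by rwa [factors_two]⟩
      refine .inl ⟨w, ?_, List.infix_refl w⟩
      obtain ⟨y, hy⟩ := exists_eq_window w
      rw [hy] at hw
      rcases mem_powerWords_or_mem hL (factorClosed_windows z) hD hw with h | ⟨hN, h⟩
      · rw [← hy] at hw h
        exact .inl ⟨hw, powerWords_mono (by omega) h⟩
      · obtain ⟨a, n, han⟩ := h
        have e : w = window y 0 C ++ window z a n ++ window y (w.length - C) C := by
          rw [← han]
          have s1 := window_split y (a := 0) (b := C) (c := w.length) (by omega) (by omega)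
          have s2 := window_split y (a := C) (b := w.length - C) (c := w.length) (by omega)
            (by omega)
          rw [s2] at s1
          simp only [sub_zero, Int.toNat_natCast, sub_sub_cancel] at s1
          rw [← hy, ← List.append_assoc,
            show ((w.length : ℤ) - C - C).toNat = w.length - 2 * C by omega] at s1
          exact s1
        rw [← hy] at hw
        rcases append_window_append_mem hp hq hr hl (s := window y 0 C)
          (t := window y (w.length - C) C) (D := C) (by simp) (by simp) a n with h | h
        · rw [← e] at h
          exact .inl ⟨hw, h⟩
        · obtain ⟨E, F, k, m, hE, hF, h⟩ := h
          exact .inr ⟨⟨hw, hwz⟩, E, F, k, m, by omega, by omega, e.trans h⟩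
    · rintro (⟨t, ht | ht, hwt⟩ | ⟨V, hV, hwV⟩)
      · exact hL hwt ht.1
      · exact hL hwt ht.1.1
      · rcases hV with h | rfl
        · exact h.elim
        · rw [factors_two] at hwV
          exact hzL hwV

/-- The first case. -/
lemma caseOne_of_wordCount [Finite α] [Nonempty α] (hL : FactorClosed L) {C : ℕ}
    (hC : ∀ n, wordCount L n ≤ n + C) (hC' : ∀ n, n ≤ wordCount L n + C)
    (hper : ∀ W : Superword α, W.factors ⊆ L → W.UniformlyRecurrent → W.Periodic) :
    CaseOne L := by
  obtain ⟨x, hxL, hx⟩ := exists_nonperiodic hL hC'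
  have hcard : ∀ n, wordCount (windows x) n ≤ n + C := fun n => by
    refine le_trans (Set.ncard_le_ncard ?_ (finite_words _ _)) (hC n)
    exact fun w hw => ⟨hxL hw.1, hw.2⟩
  obtain ⟨K, N, hK⟩ := exists_wordCount_eq hx hcard
  obtain ⟨p, q, i₀, i₁, hp, hq, h₀, h₁⟩ := exists_periodic_ends (x := x) (n₀ := N)
    (fun n hn => by rw [hK n hn, hK (n + 1) (by omega)]; omega)
    (fun y hy hur => hper _ (by rw [factors_two]; exact hy.trans hxL) hur)
  have hshift : ∀ a n, window (fun i => x (min i₀ i₁ + i)) a n = window x (min i₀ i₁ + a) n :=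
    fun a n => window_eq_window_iff.2 fun j _ => by rw [add_assoc]
  -- The origin moves to a place where the left end is already periodic and the right periodic end
  -- has not begun before it.
  refine caseOne_of_periodic_ends hL hC (z := fun i => x (min i₀ i₁ + i))
    (l := (i₀ - min i₀ i₁).toNat) ?_ ?_ hp hq ?_ ?_
  · rintro w ⟨a, n, rfl⟩
    rw [hshift]
    exact hxL (window_mem_windows _ _ _)
  · rintro ⟨r, hr, h⟩
    refine hx ⟨r, hr, fun i => ?_⟩
    have := h (i - min i₀ i₁)
    simp only [add_sub_cancel] at this
    rw [← this]
    congr 1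
    ring
  · intro i hi
    rw [← add_assoc]
    exact h₀ _ (by omega)
  · intro i hi
    rw [← add_sub_assoc]
    exact h₁ _ (by omega)

end CaseOne

end BoundaryAlgebra

theorem mainTheorem1 {k : Type*} {A : Type*} [Field k] [Ring A] [Algebra k A] {s : ℕ}
    (a : Fin s → A) (hgen : Algebra.adjoin k (Set.range a) = ⊤)
    (hbd : BoundaryAlgebra.IsBoundary k a) :
    ((¬ ∃ W : BoundaryAlgebra.Superword (Fin s),
        W.factors ⊆ BoundaryAlgebra.normalWords k a ∧ W.UniformlyRecurrent ∧ ¬ W.Periodic) →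
      BoundaryAlgebra.CaseOne (BoundaryAlgebra.normalWords k a)) ∧
    (∀ W : BoundaryAlgebra.Superword (Fin s),
        W.factors ⊆ BoundaryAlgebra.normalWords k a → W.UniformlyRecurrent → ¬ W.Periodic →
      BoundaryAlgebra.CaseTwo (BoundaryAlgebra.normalWords k a) W) := by
  have hL := BoundaryAlgebra.factorClosed_normalWords k a
  obtain ⟨C, hC⟩ := BoundaryAlgebra.exists_wordCount_bounds k a hbd
  -- The lower bound at length C + 1 produces a nonempty word, hence a letter.
  have : Nonempty (Fin s) := by
    have h1 : 0 < BoundaryAlgebra.wordCount (BoundaryAlgebra.normalWords k a) (C + 1) := by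
      have := (hC (C + 1)).2
      omega
    obtain ⟨w, -, hw⟩ := (Set.ncard_pos (BoundaryAlgebra.finite_words _ _)).1 h1
    exact ⟨w[0]⟩
  refine ⟨fun h => ?_, fun W hWL hW hper => ?_⟩
  · refine BoundaryAlgebra.caseOne_of_wordCount hL (fun n => (hC n).1) (fun n => (hC n).2) ?_
    intro W hWL hW
    by_contra hper
    exact h ⟨W, hWL, hW, hper⟩
  · exact BoundaryAlgebra.caseTwo_of_wordCount hL (fun n => (hC n).1) hWL hW hper
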